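/- Throughout, $\{0,1\}^n$ is identified with $\mathbb F_2^n$. A function $f:\{0,1\}^n\to\{-1,1\}$ is a *quadratic polynomial* if $f(x)=(-1)^{P(x)}$ for some polynomial $P\in\mathbb F_2[x_1,\dots,x_n]$ of degree at most $2$. The distance of two functions is the fraction of points in which they disagree, and $f$ is *$\delta$-far* from quadratic polynomials if its distance from each of them is at least $\delta$. For a finite $3$-uniform hypergraph $H=(V,E)$, the *hypergraph quadraticity test* is the following oracle test of a function $f:\{0,1\}^n\to\{-1,1\}$. Choose $x_v\in\{0,1\}^n$, $v\in V$, uniformly and independently at random, query $f$ at the points $\sum_{v\in S}x_v$ for all sets $S\subseteq V$ that are contained in some hyperedge (including $S=\emptyset$, which gives $f(0)$), and accept if $$f(x_i)f(x_j)f(x_k)f(x_i+x_j)f(x_i+x_k)f(x_j+x_k)f(x_i+x_j+x_k)=f(0)\quad\text{for all } e=\{i,j,k\}\in E;$$ otherwise reject. Its number of queries is the number of such sets $S$. A test *solves the degree-$2$ testing problem with perfect completeness and soundness $s$* if (a) it accepts every quadratic polynomial, in any number $n$ of variables, with certainty, and (b) there is a function $\varphi$, not depending on $n$ or $f$, with $\varphi(\epsilon)\to0$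 as $\epsilon\to0^+$, such that for all $n$, all $\epsilon>0$ and every $f:\{0,1\}^n\to\{-1,1\}$ that is $(\frac12-\epsilon)$-far from quadratic polynomials, the test accepts $f$ with probability at most $s+\varphi(\epsilon)$. **Theorem.** Let $H=(V,E)$ be a finite $3$-uniform hypergraph. Then the hypergraph quadraticity test of $H$ solves the degree-$2$ testing problem with perfect completeness and soundness $1/2^{|E|}$. Moreover, there are constants $c,C>0$ such that the following holds for the tests of the complete $3$-uniform hypergraphs. 1. For all $t\ge3$, if $q$ is the number of queries of the test of the complete $3$-uniform hypergraph on $t$ vertices, then $c\,q^{1/3}\le t\le C\,q^{1/3}$, and the test solves the degree-$2$ testing problem with perfect completeness and some soundness $s\le 2^{Cq^{2/3}}/2^q$. 2. For every integer $q\ge0$ there is an integer $t\ge 0$ with $c\,q^{1/3}\le t\le C\,q^{1/3}$ such that the test of the complete $3$-uniform hypergraph on $t$ vertices makes at most $q$ queries and solves the degree-$2$ testing problem with perfect completeness and some soundness $s\le 2^{Cq^{2/3}}/2^q$. -/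

import Mathlib

namespace HypergraphTest

universe u

/-- The Boolean cube `{0,1}ⁿ`, as the vector space `𝔽₂ⁿ`. -/
abbrev Cube (n : ℕ) : Type := Fin n → ZMod 2

/-- Boolean functions `{0,1}ⁿ → {-1,1}`; the two-element set `{-1,1}` is the group of units
of `ℤ`, so that products of values make sense. -/
abbrev BoolFun (n : ℕ) : Type := Cube n → ℤˣ

/-- `f = (-1)^P` for some `n`-variate polynomial `P` over `𝔽₂` of (total) degree at most `d`. -/
def HasDegreeRep {n : ℕ} (d : ℕ) (f : BoolFun n) : Prop :=
  ∃ P : MvPolynomial (Fin n) (ZMod 2), P.totalDegree ≤ d ∧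
    ∀ x : Cube n, f x = (-1 : ℤˣ) ^ (MvPolynomial.eval x P).val

/-- The distance of two Boolean functions: the fraction of points in which they disagree. -/
noncomputable def dist {n : ℕ} (f g : BoolFun n) : ℝ :=
  (hammingDist f g : ℝ) / 2 ^ n

/-- `f` is `δ`-far from (every Boolean function represented by) polynomials of degree
at most `d`. -/
def IsFarFromDegree {n : ℕ} (d : ℕ) (δ : ℝ) (f : BoolFun n) : Prop :=
  ∀ g : BoolFun n, HasDegreeRep d g → δ ≤ dist f g

/-- A randomized (non-adaptive) oracle test of Boolean functions in any number `n` of variables.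
It draws coins uniformly from a finite non-empty set, computes from the coins one point of the
cube for each of its queries, and decides from the coins and the answers of the oracle.
The set of queries, hence their number, does not depend on `n`. -/
structure OracleTest where
  /-- the finite set of coin outcomes, for functions of `n` variables -/
  Coins : ℕ → Type u
  [coinsFintype : ∀ n, Fintype (Coins n)]
  [coinsNonempty : ∀ n, Nonempty (Coins n)]
  /-- the finite set of labels of queries -/
  Query : Type u
  [queryFintype : Fintype Query]
  /-- the point that a query asks for -/
  point : ∀ n, Coins n → Query → Cube n
  /-- the decision, given the coins and the answers -/
  decision : ∀ n, Coins n → (Query → ℤˣ) → Prop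

namespace OracleTest

attribute [instance] coinsFintype coinsNonempty queryFintype

/-- The number of queries of the test. -/
def numQueries (T : OracleTest.{u}) : ℕ := Fintype.card T.Query

/-- The test accepts `f` when its coins are `r`. -/
def Accepts (T : OracleTest.{u}) {n : ℕ} (f : BoolFun n) (r : T.Coins n) : Prop :=
  T.decision n r fun i => f (T.point n r i)

open Classical in
/-- The probability, over uniform coins, that the test accepts `f`. -/
noncomputable def acceptProb (T : OracleTest.{u}) {n : ℕ} (f : BoolFun n) : ℝ :=
  ((Finset.univ.filter fun r : T.Coins n => T.Accepts f r).card : ℝ) /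
    (Fintype.card (T.Coins n) : ℝ)

/-- Perfect completeness of a degree-`d` test: a function which is represented by a polynomial of
degree at most `d` is always accepted. -/
def PerfectCompleteness (d : ℕ) (T : OracleTest.{u}) : Prop :=
  ∀ (n : ℕ) (f : BoolFun n), HasDegreeRep d f → ∀ r : T.Coins n, T.Accepts f r

/-- A degree-`d` test has soundness `s` if any function, in any number of variables, that is
`1/2 - ε` far from polynomials of degree at most `d` is accepted with probability at most
`s + φ(ε)`, where `φ(ε) → 0` as `ε → 0`; the function `φ` depends on the test only. -/
def HasSoundness (d : ℕ) (T : OracleTest.{u}) (s : ℝ) : Prop :=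
  ∃ φ : ℝ → ℝ, Filter.Tendsto φ (nhdsWithin 0 (Set.Ioi 0)) (nhds 0) ∧
    ∀ (n : ℕ) (f : BoolFun n) (ε : ℝ), 0 < ε → IsFarFromDegree d (1 / 2 - ε) f →
      T.acceptProb f ≤ s + φ ε

/-- The test solves the degree-`d` testing problem with perfect completeness and soundness `s`. -/
def SolvesDegreeTesting (d : ℕ) (T : OracleTest.{u}) (s : ℝ) : Prop :=
  T.PerfectCompleteness d ∧ T.HasSoundness d s

end OracleTest

/-- A `k`-uniform hypergraph on the vertex set `V`. -/
structure UniformHypergraph (V : Type u) (k : ℕ) where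
  /-- the set `E` of hyperedges -/
  edges : Finset (Finset V)
  uniform : ∀ e ∈ edges, e.card = k

/-- The complete `k`-uniform hypergraph on `t` vertices. -/
def UniformHypergraph.complete (t k : ℕ) : UniformHypergraph (Fin t) k where
  edges := Finset.powersetCard k Finset.univ
  uniform _ he := (Finset.mem_powersetCard.1 he).2

/-- The subsets of hyperedges (the empty set included, if there is a hyperedge at all). -/
def UniformHypergraph.faces {V : Type u} [DecidableEq V] {k : ℕ} (H : UniformHypergraph V k) :
    Finset (Finset V) :=
  H.edges.biUnion Finset.powerset

theorem UniformHypergraph.mem_faces {V : Type u} [DecidableEq V] {k : ℕ}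
    (H : UniformHypergraph V k) {e S : Finset V} (he : e ∈ H.edges) (hS : S ⊆ e) :
    S ∈ H.faces :=
  Finset.mem_biUnion.2 ⟨e, he, Finset.mem_powerset.2 hS⟩

/-- The hypergraph quadraticity test: choose points `x_v`, one for each vertex `v`, uniformly and
independently in `{0,1}ⁿ`; for each face `S` query `f` at `∑ v ∈ S, x_v` (the empty face gives
the query `f(0)`); accept if for each hyperedge `e` the product of the seven answers at the
non-empty subsets of `e` is `f(0)`. -/
def quadraticityTest {V : Type u} [Fintype V] [DecidableEq V] (H : UniformHypergraph V 3) :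
    OracleTest.{u} where
  Coins n := V → Cube n
  Query := {S : Finset V // S ∈ H.faces}
  point _ x S := ∑ v ∈ S.1, x v
  decision _ _ a := ∀ (e : Finset V) (he : e ∈ H.edges),
    ∏ S ∈ (e.powerset.erase ∅).attach,
        a ⟨S.1, H.mem_faces he (Finset.mem_powerset.1 (Finset.mem_of_mem_erase S.2))⟩ =
      a ⟨∅, H.mem_faces he (Finset.empty_subset e)⟩

theorem quadraticityTest_numQueries {V : Type u} [Fintype V] [DecidableEq V]
    (H : UniformHypergraph V 3) : (quadraticityTest H).numQueries = H.faces.card :=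
  Fintype.card_coe H.faces

/-- The acceptance condition of the test as a condition on `f`. -/
theorem quadraticityTest_accepts_iff {V : Type u} [Fintype V] [DecidableEq V]
    (H : UniformHypergraph V 3) {n : ℕ} (f : BoolFun n) (x : V → Cube n) :
    (quadraticityTest H).Accepts f x ↔
      ∀ e ∈ H.edges, ∏ S ∈ e.powerset.erase ∅, f (∑ v ∈ S, x v) = f 0 := by
  have h : ∀ e : Finset V, ∏ S ∈ (e.powerset.erase ∅).attach, f (∑ v ∈ S.1, x v) =
      ∏ S ∈ e.powerset.erase ∅, f (∑ v ∈ S, x v) := fun e =>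
    Finset.prod_attach (e.powerset.erase ∅) fun S => f (∑ v ∈ S, x v)
  refine forall₂_congr fun e _ => ?_
  rw [← h e]
  simp [quadraticityTest]

/-- The acceptance condition of the test, written out with the seven factors. -/
theorem quadraticityTest_accepts_iff' {V : Type u} [Fintype V] [DecidableEq V]
    (H : UniformHypergraph V 3) {n : ℕ} (f : BoolFun n) (x : V → Cube n) :
    (quadraticityTest H).Accepts f x ↔
      ∀ i j k : V, i ≠ j → i ≠ k → j ≠ k → ({i, j, k} : Finset V) ∈ H.edges →
        f (x i) * f (x j) * f (x k) * f (x i + x j) * f (x i + x k) * f (x j + x k) *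
          f (x i + x j + x k) = f 0 := by
  have key : ∀ i j k : V, i ≠ j → i ≠ k → j ≠ k →
      ∏ S ∈ ({i, j, k} : Finset V).powerset.erase ∅, f (∑ v ∈ S, x v) =
        f (x i) * f (x j) * f (x k) * f (x i + x j) * f (x i + x k) * f (x j + x k) *
          f (x i + x j + x k) := by
    intro i j k hij hik hjk
    have hs : f 0 * ∏ S ∈ ({i, j, k} : Finset V).powerset.erase ∅, f (∑ v ∈ S, x v) =
        ∏ S ∈ ({i, j, k} : Finset V).powerset, f (∑ v ∈ S, x v) := by
      rw [← Finset.mul_prod_erase _ _ (Finset.empty_mem_powerset _), Finset.sum_empty]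
    rw [Finset.prod_powerset_insert (by simp [hij, hik]),
      Finset.prod_powerset_insert (by simp [hjk]),
      Finset.prod_powerset_insert (by simp [hjk])] at hs
    have hk : ∀ F : Finset V → ℤˣ, ∏ t ∈ ({k} : Finset V).powerset, F t = F ∅ * F {k} := by
      intro F
      rw [← insert_empty_eq k, Finset.prod_powerset_insert (by simp)]
      simp
    rw [hk, hk, hk, hk] at hs
    have h0 : ∑ v ∈ (∅ : Finset V), x v = 0 := Finset.sum_empty
    have hjk' : ∑ v ∈ ({j, k} : Finset V), x v = x j + x k := Finset.sum_pair hjk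
    have hik' : ∑ v ∈ ({i, k} : Finset V), x v = x i + x k := Finset.sum_pair hik
    have hij' : ∑ v ∈ ({i, j} : Finset V), x v = x i + x j := Finset.sum_pair hij
    have hijk : ∑ v ∈ ({i, j, k} : Finset V), x v = x i + x j + x k := by
      rw [Finset.sum_insert (by simp [hij, hik]), hjk', add_assoc]
    simp only [insert_empty_eq, Finset.sum_singleton, h0, hjk', hik', hij', hijk] at hs
    refine mul_left_cancel (a := f 0) (hs.trans ?_)
    simp only [mul_assoc, mul_comm, mul_left_comm]
  rw [quadraticityTest_accepts_iff]
  constructor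
  · intro h i j k hij hik hjk he
    rw [← key i j k hij hik hjk]
    exact h _ he
  · intro h e he
    obtain ⟨i, j, k, hij, hik, hjk, rfl⟩ := Finset.card_eq_three.1 (H.uniform e he)
    rw [key i j k hij hik hjk]
    exact h i j k hij hik hjk he

end HypergraphTest

namespace HypergraphTest

open Finset Matrix
open scoped Pointwise

/-! ### Fourier analysis on the cube -/

/-- The character `(-1)^a`, with real values. -/
def sgn (a : ZMod 2) : ℝ := (-1) ^ a.val

@[simp] theorem sgn_zero : sgn 0 = 1 := by simp [sgn]

@[simp] theorem sgn_one : sgn 1 = -1 := by simp [sgn, ZMod.val_one]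

theorem zmod_two_cases (a : ZMod 2) : a = 0 ∨ a = 1 := by
  revert a; decide

theorem sgn_add (a b : ZMod 2) : sgn (a + b) = sgn a * sgn b := by
  rcases zmod_two_cases a with rfl | rfl <;> rcases zmod_two_cases b with rfl | rfl <;>
    simp [CharTwo.add_self_eq_zero]

theorem sgn_mul_self (a : ZMod 2) : sgn a * sgn a = 1 := by
  rw [← sgn_add, CharTwo.add_self_eq_zero, sgn_zero]

theorem sgn_sq (a : ZMod 2) : sgn a ^ 2 = 1 := by
  rw [sq, sgn_mul_self]

variable {n : ℕ}

theorem cube_add_self (x : Cube n) : x + x = 0 :=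
  funext fun _ => CharTwo.add_self_eq_zero _

theorem cube_add_cancel (x y : Cube n) : x + (x + y) = y := by
  rw [← add_assoc, cube_add_self, zero_add]

theorem cube_add_eq_zero {x y : Cube n} : x + y = 0 ↔ x = y := by
  constructor
  · intro h
    rw [← cube_add_cancel x y, h, add_zero]
  · rintro rfl
    exact cube_add_self _

/-- The number of points of the cube, as a real number. -/
def size (n : ℕ) : ℝ := 2 ^ n

theorem size_pos (n : ℕ) : 0 < size n := by
  rw [size]
  positivity

theorem card_cube (n : ℕ) : (Fintype.card (Cube n) : ℝ) = size n := by
  simp [size]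

theorem sum_one_cube (n : ℕ) : ∑ _x : Cube n, (1 : ℝ) = size n := by
  rw [← card_cube, sum_const, card_univ, nsmul_eq_mul, mul_one]

theorem sum_add_left (a : Cube n) (F : Cube n → ℝ) : ∑ x, F (a + x) = ∑ x, F x :=
  Equiv.sum_comp (Equiv.addLeft a) F

theorem sum_add_right (a : Cube n) (F : Cube n → ℝ) : ∑ x, F (x + a) = ∑ x, F x :=
  Equiv.sum_comp (Equiv.addRight a) F

theorem sum_sgn_dotProduct (x : Cube n) :
    ∑ a : Cube n, sgn (a ⬝ᵥ x) = if x = 0 then size n else 0 := by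
  split_ifs with h
  · subst h
    simp only [dotProduct_zero, sgn_zero, sum_one_cube]
  · obtain ⟨i, hi⟩ := Function.ne_iff.1 h
    have hi' : x i = 1 := (zmod_two_cases (x i)).resolve_left hi
    have := sum_add_right (Pi.single i 1) fun a => sgn (a ⬝ᵥ x)
    simp only [add_dotProduct, single_dotProduct, sgn_add, hi', mul_one, sgn_one, mul_neg,
      sum_neg_distrib] at this
    linarith

/-- The (unnormalised) Fourier coefficient. -/
def fourier (g : Cube n → ℝ) (a : Cube n) : ℝ := ∑ x, g x * sgn (a ⬝ᵥ x)

theorem sum_fourier_sq (g : Cube n → ℝ) :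
    ∑ a, fourier g a ^ 2 = size n * ∑ x, g x ^ 2 := by
  have h : ∀ a, fourier g a ^ 2 = ∑ x, ∑ y, g x * g y * sgn (a ⬝ᵥ (x + y)) := by
    intro a
    rw [sq, fourier, sum_mul_sum]
    refine sum_congr rfl fun x _ => sum_congr rfl fun y _ => ?_
    rw [dotProduct_add, sgn_add]
    ring
  simp only [h]
  rw [sum_comm, mul_sum]
  refine sum_congr rfl fun x _ => ?_
  rw [sum_comm]
  simp only [← mul_sum, sum_sgn_dotProduct, cube_add_eq_zero, mul_ite, mul_zero]
  rw [sum_ite_eq]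
  simp
  ring

theorem fourier_correlation (g₀ g₁ : Cube n → ℝ) (a : Cube n) :
    fourier (fun h => ∑ x, g₀ x * g₁ (x + h)) a = fourier g₀ a * fourier g₁ a := by
  simp only [fourier, sum_mul]
  rw [sum_comm]
  refine sum_congr rfl fun x _ => ?_
  rw [← sum_add_left x, mul_sum]
  refine sum_congr rfl fun y _ => ?_
  rw [cube_add_cancel, dotProduct_add, sgn_add]
  ring

/-- The inverse theorem for the Gowers `U²`-norm. -/
theorem exists_fourier_sq_ge (g₀ g₁ : Cube n → ℝ) (hg : ∀ x, g₁ x ^ 2 ≤ 1) :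
    ∃ a, ∑ h, (∑ x, g₀ x * g₁ (x + h)) ^ 2 ≤ size n * fourier g₀ a ^ 2 := by
  obtain ⟨a, -, ha⟩ := exists_max_image univ (fun a => fourier g₀ a ^ 2) univ_nonempty
  refine ⟨a, le_of_mul_le_mul_left ?_ (size_pos n)⟩
  rw [← sum_fourier_sq]
  simp only [fourier_correlation, mul_pow]
  calc ∑ b, fourier g₀ b ^ 2 * fourier g₁ b ^ 2
      ≤ ∑ b, fourier g₀ a ^ 2 * fourier g₁ b ^ 2 :=
        sum_le_sum fun b _ => mul_le_mul_of_nonneg_right (ha b (mem_univ b)) (sq_nonneg _)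
    _ = fourier g₀ a ^ 2 * (size n * ∑ x, g₁ x ^ 2) := by rw [← mul_sum, sum_fourier_sq]
    _ ≤ fourier g₀ a ^ 2 * (size n * ∑ x : Cube n, 1) := by
        have := size_pos n
        gcongr with x
        exact hg x
    _ = size n * (size n * fourier g₀ a ^ 2) := by
        rw [sum_one_cube]
        ring

/-! ### The Cauchy–Schwarz inequality -/

theorem sq_sum_mul_le {ι : Type*} [Fintype ι] (a b : ι → ℝ) (ha : ∀ i, a i ^ 2 ≤ 1) :
    (∑ i, a i * b i) ^ 2 ≤ Fintype.card ι * ∑ i, b i ^ 2 := by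
  refine (sum_mul_sq_le_sq_mul_sq univ a b).trans ?_
  refine mul_le_mul_of_nonneg_right ?_ (sum_nonneg fun i _ => sq_nonneg _)
  exact (sum_le_sum fun i _ => ha i).trans (by simp)

theorem sq_sum_sum_mul_le (a b : Cube n → Cube n → ℝ) (ha : ∀ x y, a x y ^ 2 ≤ 1) :
    (∑ x, ∑ y, a x y * b x y) ^ 2 ≤ size n ^ 2 * ∑ x, ∑ y, b x y ^ 2 := by
  have := sq_sum_mul_le (fun p : Cube n × Cube n => a p.1 p.2) (fun p => b p.1 p.2)
    fun p => ha p.1 p.2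
  simpa only [Fintype.sum_prod_type, Fintype.card_prod, Nat.cast_mul, Nat.cast_pow, card_cube, ← sq] using this

theorem sq_sum_sum_sum_mul_le (a b : Cube n → Cube n → Cube n → ℝ)
    (ha : ∀ x y z, a x y z ^ 2 ≤ 1) :
    (∑ x, ∑ y, ∑ z, a x y z * b x y z) ^ 2 ≤ size n ^ 3 * ∑ x, ∑ y, ∑ z, b x y z ^ 2 := by
  have := sq_sum_mul_le (fun p : Cube n × Cube n × Cube n => a p.1 p.2.1 p.2.2)
    (fun p => b p.1 p.2.1 p.2.2) fun p => ha p.1 p.2.1 p.2.2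
  simpa only [Fintype.sum_prod_type, Fintype.card_prod, Nat.cast_mul, Nat.cast_pow, card_cube, ← sq, ← pow_succ',
    Nat.reduceAdd] using this

theorem sq_sum_sum_sum_sum_mul_le (a b : Cube n → Cube n → Cube n → Cube n → ℝ)
    (ha : ∀ x y z w, a x y z w ^ 2 ≤ 1) :
    (∑ x, ∑ y, ∑ z, ∑ w, a x y z w * b x y z w) ^ 2 ≤
      size n ^ 4 * ∑ x, ∑ y, ∑ z, ∑ w, b x y z w ^ 2 := by
  have := sq_sum_mul_le (fun p : Cube n × Cube n × Cube n × Cube n => a p.1 p.2.1 p.2.2.1 p.2.2.2)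
    (fun p => b p.1 p.2.1 p.2.2.1 p.2.2.2) fun p => ha p.1 p.2.1 p.2.2.1 p.2.2.2
  simpa only [Fintype.sum_prod_type, Fintype.card_prod, Nat.cast_mul, Nat.cast_pow, card_cube, ← sq, ← pow_succ',
    Nat.reduceAdd] using this

/-! ### The Gowers–Cauchy–Schwarz inequality -/

/-- The eighth power of the Gowers `U³`-norm, without normalisation. -/
def cubeSum (f : Cube n → ℝ) : ℝ :=
  ∑ h, ∑ k, (∑ x, f x * f (x + h) * f (x + k) * f (x + h + k)) ^ 2

theorem cubeSum_eq (f : Cube n → ℝ) (s : Cube n) :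
    ∑ x, ∑ x', ∑ z, ∑ z', (∑ y, f (s + x + y + z) * f (s + x' + y + z) *
      f (s + x + y + z') * f (s + x' + y + z')) ^ 2 = size n ^ 2 * cubeSum f := by
  have h1 : ∀ x x' z z' : Cube n, ∑ y, f (s + x + y + z) * f (s + x' + y + z) *
      f (s + x + y + z') * f (s + x' + y + z') =
      ∑ y, f y * f (y + (x + x')) * f (y + (z + z')) * f (y + (x + x') + (z + z')) := by
    intro x x' z z'
    refine Eq.trans ?_ (sum_add_left (s + x + z) fun y =>
      f y * f (y + (x + x')) * f (y + (z + z')) * f (y + (x + x') + (z + z')))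
    refine sum_congr rfl fun y _ => ?_
    have e1 : s + x + z + y + (x + x') = s + x' + y + z := by
      rw [show s + x + z + y + (x + x') = s + x' + y + z + (x + x) by abel, cube_add_self, add_zero]
    have e2 : s + x + z + y + (z + z') = s + x + y + z' := by
      rw [show s + x + z + y + (z + z') = s + x + y + z' + (z + z) by abel, cube_add_self, add_zero]
    have e3 : s + x + z + y + (x + x') + (z + z') = s + x' + y + z' := by
      rw [e1, show s + x' + y + z + (z + z') = s + x' + y + z' + (z + z) by abel, cube_add_self,
        add_zero]
    rw [e3, e1, e2, show s + x + z + y = s + x + y + z by abel]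
  simp only [h1]
  have h2 : ∀ G : Cube n → Cube n → ℝ,
      ∑ x, ∑ x', ∑ z, ∑ z', G (x + x') (z + z') = size n ^ 2 * ∑ h, ∑ k, G h k := by
    intro G
    have : ∀ x x' : Cube n, ∑ z, ∑ z', G (x + x') (z + z') = size n * ∑ k, G (x + x') k := by
      intro x x'
      simp only [sum_add_left _ fun k => G (x + x') k]
      rw [← sum_one_cube, sum_mul]
      simp
    simp only [this]
    simp only [sum_add_left _ fun h => size n * ∑ k, G h k]
    rw [← mul_sum, sq, mul_assoc, ← sum_one_cube, sum_mul]
    simp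
  exact h2 fun h k => (∑ y, f y * f (y + h) * f (y + k) * f (y + h + k)) ^ 2

theorem mul_sq_le_one {a b : ℝ} (ha : a ^ 2 ≤ 1) (hb : b ^ 2 ≤ 1) : (a * b) ^ 2 ≤ 1 := by
  rw [mul_pow]
  exact mul_le_one₀ ha (sq_nonneg _) hb

theorem sum_sq_eq {ι : Type*} [Fintype ι] (a : ι → ℝ) : (∑ i, a i) ^ 2 = ∑ i, ∑ j, a i * a j := by
  rw [sq, sum_mul_sum]

theorem sum_pow_eight_le (f : Cube n → ℝ) (s : Cube n) (A B C : Cube n → Cube n → ℝ)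
    (hA : ∀ x y, A x y ^ 2 ≤ 1) (hB : ∀ x y, B x y ^ 2 ≤ 1) (hC : ∀ x y, C x y ^ 2 ≤ 1) :
    (∑ x, ∑ y, ∑ z, f (s + x + y + z) * (A x y * B x z * C y z)) ^ 8 ≤
      size n ^ 20 * cubeSum f := by
  set T := ∑ x, ∑ y, ∑ z, f (s + x + y + z) * (A x y * B x z * C y z) with hT
  set T₂ := ∑ y, ∑ z, (∑ x, A x y * B x z * f (s + x + y + z)) ^ 2 with hT₂
  set T₃ := ∑ x, ∑ x', ∑ y, (∑ z, B x z * B x' z * (f (s + x + y + z) * f (s + x' + y + z))) ^ 2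
    with hT₃
  have hN := size_pos n
  have h1 : T ^ 2 ≤ size n ^ 2 * T₂ := by
    refine le_trans (le_of_eq ?_) (sq_sum_sum_mul_le C _ hC)
    congr 1
    rw [hT, sum_comm]
    refine sum_congr rfl fun y _ => ?_
    rw [sum_comm]
    refine sum_congr rfl fun z _ => ?_
    rw [mul_sum]
    exact sum_congr rfl fun x _ => by ring
  have h2 : T₂ ^ 2 ≤ size n ^ 3 * T₃ := by
    refine le_trans (le_of_eq ?_) (sq_sum_sum_sum_mul_le (fun x x' y => A x y * A x' y) _
      fun x x' y => mul_sq_le_one (hA _ _) (hA _ _))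
    congr 1
    simp only [hT₂, sum_sq_eq, mul_sum]
    calc _ = ∑ y, ∑ x, ∑ x', ∑ z, A x y * B x z * f (s + x + y + z) *
          (A x' y * B x' z * f (s + x' + y + z)) := by
          refine sum_congr rfl fun y _ => ?_
          rw [sum_comm]
          refine sum_congr rfl fun x _ => ?_
          rw [sum_comm]
      _ = _ := by
          rw [sum_comm]
          refine sum_congr rfl fun x _ => ?_
          rw [sum_comm]
          refine sum_congr rfl fun x' _ => sum_congr rfl fun y _ => sum_congr rfl fun z _ => ?_
          ring
  have h3 : T₃ ^ 2 ≤ size n ^ 4 * (size n ^ 2 * cubeSum f) := by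
    rw [← cubeSum_eq f s]
    refine le_trans (le_of_eq ?_) (sq_sum_sum_sum_sum_mul_le
      (fun x x' z z' => B x z * B x' z * (B x z' * B x' z')) _
      fun x x' z z' => mul_sq_le_one (mul_sq_le_one (hB _ _) (hB _ _))
        (mul_sq_le_one (hB _ _) (hB _ _)))
    congr 1
    rw [hT₃]
    refine sum_congr rfl fun x _ => sum_congr rfl fun x' _ => ?_
    simp only [sum_sq_eq, mul_sum]
    rw [sum_comm]
    refine sum_congr rfl fun z _ => ?_
    rw [sum_comm]
    refine sum_congr rfl fun z' _ => sum_congr rfl fun y _ => ?_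
    ring
  have hT₂0 : 0 ≤ T₂ := sum_nonneg fun _ _ => sum_nonneg fun _ _ => sq_nonneg _
  have hT₃0 : 0 ≤ T₃ :=
    sum_nonneg fun _ _ => sum_nonneg fun _ _ => sum_nonneg fun _ _ => sq_nonneg _
  clear_value T T₂ T₃
  calc T ^ 8 = (T ^ 2) ^ 4 := by ring
    _ ≤ (size n ^ 2 * T₂) ^ 4 := by gcongr
    _ = size n ^ 8 * (T₂ ^ 2) ^ 2 := by ring
    _ ≤ size n ^ 8 * (size n ^ 3 * T₃) ^ 2 := by gcongr
    _ = size n ^ 14 * T₃ ^ 2 := by ring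
    _ ≤ size n ^ 14 * (size n ^ 4 * (size n ^ 2 * cubeSum f)) := by gcongr
    _ = size n ^ 20 * cubeSum f := by ring

/-! ### The acceptance probability -/

/-- Products of bounded functions of two out of three variables. -/
def IsPairwiseProduct (G : Cube n → Cube n → Cube n → ℝ) : Prop :=
  ∃ A B C : Cube n → Cube n → ℝ, (∀ x y, A x y ^ 2 ≤ 1) ∧ (∀ x y, B x y ^ 2 ≤ 1) ∧
    (∀ x y, C x y ^ 2 ≤ 1) ∧ ∀ x y z, G x y z = A x y * B x z * C y z

theorem IsPairwiseProduct.one : IsPairwiseProduct fun _ _ _ : Cube n => 1 :=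
  ⟨1, 1, 1, by simp, by simp, by simp, by simp⟩

theorem IsPairwiseProduct.mul {G G' : Cube n → Cube n → Cube n → ℝ} (h : IsPairwiseProduct G)
    (h' : IsPairwiseProduct G') : IsPairwiseProduct fun x y z => G x y z * G' x y z := by
  obtain ⟨A, B, C, hA, hB, hC, hG⟩ := h
  obtain ⟨A', B', C', hA', hB', hC', hG'⟩ := h'
  refine ⟨fun x y => A x y * A' x y, fun x y => B x y * B' x y, fun x y => C x y * C' x y,
    fun _ _ => mul_sq_le_one (hA _ _) (hA' _ _), fun _ _ => mul_sq_le_one (hB _ _) (hB' _ _),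
    fun _ _ => mul_sq_le_one (hC _ _) (hC' _ _), fun x y z => ?_⟩
  simp only [hG, hG']
  ring

theorem IsPairwiseProduct.prod {ι : Type*} (s : Finset ι) (G : ι → Cube n → Cube n → Cube n → ℝ)
    (h : ∀ i ∈ s, IsPairwiseProduct (G i)) : IsPairwiseProduct fun x y z => ∏ i ∈ s, G i x y z := by
  classical
  induction s using Finset.induction_on with
  | empty => simpa using IsPairwiseProduct.one
  | insert i s hi ih =>
    simp only [prod_insert hi]
    exact (h i (mem_insert_self _ _)).mul (ih fun j hj => h j (mem_insert_of_mem hj))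

theorem abs_sum_le_of_isPairwiseProduct {f : Cube n → ℝ} {δ : ℝ} (hδ : 0 ≤ δ)
    (hf : cubeSum f ≤ δ ^ 8 * size n ^ 4) {G : Cube n → Cube n → Cube n → ℝ}
    (hG : IsPairwiseProduct G) (s : Cube n) :
    |∑ x, ∑ y, ∑ z, f (s + x + y + z) * G x y z| ≤ δ * size n ^ 3 := by
  obtain ⟨A, B, C, hA, hB, hC, hG⟩ := hG
  have hN := size_pos n
  simp only [hG]
  refine le_of_pow_le_pow_left₀ (n := 8) (by norm_num) (by positivity) ?_
  rw [Even.pow_abs (by decide)]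
  refine (sum_pow_eight_le f s A B C hA hB hC).trans ?_
  calc size n ^ 20 * cubeSum f ≤ size n ^ 20 * (δ ^ 8 * size n ^ 4) := by gcongr
    _ = (δ * size n ^ 3) ^ 8 := by ring

section Acceptance

variable {V : Type*} [DecidableEq V]

theorem sum_shift (S : Finset V) (x : V → Cube n) (i : V) (a : Cube n) :
    ∑ v ∈ S, (x + Pi.single i a : V → Cube n) v = ∑ v ∈ S, x v + if i ∈ S then a else 0 := by
  simp only [Pi.add_apply, sum_add_distrib, sum_pi_single']

variable [Fintype V]

theorem abs_sum_prod_le (H : UniformHypergraph V 3) {f : Cube n → ℝ} (hf1 : ∀ x, f x ^ 2 ≤ 1)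
    {δ : ℝ} (hδ : 0 ≤ δ) (hf : cubeSum f ≤ δ ^ 8 * size n ^ 4) {T : Finset (Finset V)}
    (hT : T ⊆ H.edges) (hne : T.Nonempty) :
    |∑ x : V → Cube n, ∏ e ∈ T, ∏ S ∈ e.powerset, f (∑ v ∈ S, x v)| ≤
      δ * Fintype.card (V → Cube n) := by
  obtain ⟨e₀, he₀⟩ := hne
  obtain ⟨i, j, k, hij, hik, hjk, he⟩ := Finset.card_eq_three.1 (H.uniform e₀ (hT he₀))
  set P : (V → Cube n) → ℝ := fun x => ∏ e ∈ T, ∏ S ∈ e.powerset, f (∑ v ∈ S, x v) with hP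
  let sh : (V → Cube n) → Cube n → Cube n → Cube n → V → Cube n :=
    fun x a b c => x + Pi.single i a + Pi.single j b + Pi.single k c
  have hsh : ∀ x a b c (S : Finset V), ∑ v ∈ S, sh x a b c v = ∑ v ∈ S, x v +
      (if i ∈ S then a else 0) + (if j ∈ S then b else 0) + (if k ∈ S then c else 0) := by
    intro x a b c S
    simp only [sh, sum_shift]
  have hrest : ∀ x (S : Finset V), ¬ e₀ ⊆ S →
      IsPairwiseProduct fun a b c => f (∑ v ∈ S, sh x a b c v) := by
    intro x S hS
    simp only [hsh]
    have : i ∉ S ∨ j ∉ S ∨ k ∉ S := by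
      by_contra! h
      refine hS ?_
      rw [he]
      intro v hv
      simp only [mem_insert, mem_singleton] at hv
      rcases hv with rfl | rfl | rfl
      exacts [h.1, h.2.1, h.2.2]
    rcases this with h | h | h
    · refine ⟨1, 1, fun b c => f (∑ v ∈ S, x v + (if j ∈ S then b else 0) +
        (if k ∈ S then c else 0)), by simp, by simp, fun _ _ => hf1 _, ?_⟩
      simp [h]
    · refine ⟨1, fun a c => f (∑ v ∈ S, x v + (if i ∈ S then a else 0) +
        (if k ∈ S then c else 0)), 1, by simp, fun _ _ => hf1 _, by simp, ?_⟩
      simp [h]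
    · refine ⟨fun a b => f (∑ v ∈ S, x v + (if i ∈ S then a else 0) +
        (if j ∈ S then b else 0)), 1, 1, fun _ _ => hf1 _, by simp, by simp, ?_⟩
      simp [h]
  have hfac : ∀ x, ∃ G, IsPairwiseProduct G ∧ ∀ a b c,
      P (sh x a b c) = f (∑ v ∈ e₀, x v + a + b + c) * G a b c := by
    intro x
    refine ⟨fun a b c => (∏ S ∈ e₀.powerset.erase e₀, f (∑ v ∈ S, sh x a b c v)) *
      ∏ e ∈ T.erase e₀, ∏ S ∈ e.powerset, f (∑ v ∈ S, sh x a b c v), ?_, ?_⟩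
    · refine IsPairwiseProduct.mul (IsPairwiseProduct.prod _ _ fun S hS => hrest x S ?_)
        (IsPairwiseProduct.prod _ _ fun e he' => IsPairwiseProduct.prod _ _ fun S hS =>
          hrest x S ?_)
      · intro h
        rw [mem_erase, mem_powerset] at hS
        exact hS.1 (hS.2.antisymm h)
      · intro h
        rw [mem_erase] at he'
        rw [mem_powerset] at hS
        refine he'.1 (eq_of_subset_of_card_le (h.trans hS) ?_).symm
        rw [H.uniform e (hT he'.2), H.uniform e₀ (hT he₀)]
    · intro a b c
      rw [hP]
      dsimp only
      rw [← mul_prod_erase T _ he₀, ← mul_prod_erase e₀.powerset _ (mem_powerset_self e₀), hsh,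
        if_pos (by simp [he]), if_pos (by simp [he]), if_pos (by simp [he]), mul_assoc]
  have hbound : ∀ x, |∑ a, ∑ b, ∑ c, P (sh x a b c)| ≤ δ * size n ^ 3 := by
    intro x
    obtain ⟨G, hG, h⟩ := hfac x
    simp only [h]
    exact abs_sum_le_of_isPairwiseProduct hδ hf hG _
  have havg : size n ^ 3 * ∑ x, P x = ∑ x, ∑ a, ∑ b, ∑ c, P (sh x a b c) := by
    have h1 : ∀ a b c, ∑ x, P (sh x a b c) = ∑ x, P x := by
      intro a b c
      have := Equiv.sum_comp (Equiv.addRight (Pi.single i a + Pi.single j b + Pi.single k c)) P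
      rw [← this]
      refine sum_congr rfl fun x _ => ?_
      simp [sh, add_assoc]
    have h2 : ∑ x, ∑ a, ∑ b, ∑ c, P (sh x a b c) = ∑ a, ∑ b, ∑ c, ∑ x, P (sh x a b c) := by
      rw [sum_comm]
      refine sum_congr rfl fun a _ => ?_
      rw [sum_comm]
      refine sum_congr rfl fun b _ => ?_
      rw [sum_comm]
    rw [h2]
    simp only [h1, sum_const, card_univ, nsmul_eq_mul, card_cube]
    ring
  have hN := size_pos n
  refine le_of_mul_le_mul_left ?_ (pow_pos hN 3)
  calc size n ^ 3 * |∑ x, P x| = |∑ x, ∑ a, ∑ b, ∑ c, P (sh x a b c)| := by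
        rw [← havg, abs_mul, abs_of_pos (pow_pos hN 3)]
    _ ≤ ∑ x : V → Cube n, δ * size n ^ 3 :=
        (abs_sum_le_sum_abs _ _).trans (sum_le_sum fun x _ => hbound x)
    _ = size n ^ 3 * (δ * Fintype.card (V → Cube n)) := by
        rw [sum_const, card_univ, nsmul_eq_mul]
        ring

/-- A Boolean function, with real values. -/
def realFun (f : BoolFun n) (x : Cube n) : ℝ := ((f x : ℤ) : ℝ)

theorem realFun_sq (f : BoolFun n) (x : Cube n) : realFun f x ^ 2 = 1 := by
  rcases Int.units_eq_one_or (f x) with h | h <;> simp [realFun, h]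

theorem prod_realFun {ι : Type*} (s : Finset ι) (f : BoolFun n) (p : ι → Cube n) :
    ∏ i ∈ s, realFun f (p i) = (((∏ i ∈ s, f (p i) : ℤˣ) : ℤ) : ℝ) := by
  simp [realFun]

theorem units_mul_eq_one (u v : ℤˣ) : u * v = 1 ↔ v = u := by
  rcases Int.units_eq_one_or u with rfl | rfl <;> rcases Int.units_eq_one_or v with rfl | rfl <;>
    decide

theorem half_one_add_unit (u : ℤˣ) : (1 + ((u : ℤ) : ℝ)) / 2 = if u = 1 then 1 else 0 := by
  rcases Int.units_eq_one_or u with rfl | rfl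
  · norm_num
  · rw [if_neg (by decide)]
    norm_num

open Classical in
theorem acceptProb_le (H : UniformHypergraph V 3) (f : BoolFun n) {δ : ℝ} (hδ : 0 ≤ δ)
    (hf : cubeSum (realFun f) ≤ δ ^ 8 * size n ^ 4) :
    (quadraticityTest H).acceptProb f ≤ 1 / 2 ^ H.edges.card + δ := by
  set F : (V → Cube n) → Finset V → ℝ := fun x e =>
    ∏ S ∈ e.powerset, realFun f (∑ v ∈ S, x v) with hF
  have hacc : ∀ x : V → Cube n, (if (quadraticityTest H).Accepts f x then (1 : ℝ) else 0) =
      ∏ e ∈ H.edges, (1 + F x e) / 2 := by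
    intro x
    have h1 : ∀ e, (1 + F x e) / 2 =
        if ∏ S ∈ e.powerset.erase ∅, f (∑ v ∈ S, x v) = f 0 then 1 else 0 := by
      intro e
      rw [hF]
      dsimp only
      rw [prod_realFun, half_one_add_unit, ← mul_prod_erase _ _ (empty_mem_powerset e), sum_empty]
      exact if_congr (units_mul_eq_one _ _) rfl rfl
    simp only [h1]
    rw [prod_ite_zero, prod_const_one]
    by_cases h : (quadraticityTest H).Accepts f x
    · rw [if_pos h, if_pos ((quadraticityTest_accepts_iff H f x).1 h)]
    · rw [if_neg h, if_neg fun h' => h ((quadraticityTest_accepts_iff H f x).2 h')]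
  have hcard : (0 : ℝ) < Fintype.card (V → Cube n) := by exact_mod_cast Fintype.card_pos
  have hsum : ((univ.filter fun r : (quadraticityTest H).Coins n =>
       (quadraticityTest H).Accepts f r).card : ℝ) =
      1 / 2 ^ H.edges.card * ∑ T ∈ H.edges.powerset, ∑ x, ∏ e ∈ T, F x e := by
    refine (natCast_card_filter _ _).trans ?_
    change ∑ x : V → Cube n, (if (quadraticityTest H).Accepts f x then (1 : ℝ) else 0) = _
    simp only [hacc, prod_div_distrib, prod_const, prod_one_add]
    rw [sum_comm, ← sum_div]
    ring
  have hle : ∑ T ∈ H.edges.powerset, ∑ x, ∏ e ∈ T, F x e ≤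
      Fintype.card (V → Cube n) * (1 + 2 ^ H.edges.card * δ) := by
    rw [← add_sum_erase _ _ (empty_mem_powerset _)]
    simp only [prod_empty, sum_const, card_univ, nsmul_eq_mul, mul_one]
    have : ∑ T ∈ H.edges.powerset.erase ∅, ∑ x, ∏ e ∈ T, F x e ≤
        ∑ T ∈ H.edges.powerset, δ * Fintype.card (V → Cube n) := by
      refine (sum_le_sum fun T hT => ?_).trans (sum_le_sum_of_subset_of_nonneg (erase_subset _ _)
        fun _ _ _ => by positivity)
      rw [mem_erase, mem_powerset] at hT
      exact (le_abs_self _).trans (abs_sum_prod_le H (fun x => (realFun_sq f x).le) hδ hf hT.2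
        (nonempty_iff_ne_empty.2 hT.1))
    rw [sum_const, card_powerset, nsmul_eq_mul] at this
    push_cast at this ⊢
    linarith
  change (_ : ℝ) / (Fintype.card (V → Cube n) : ℝ) ≤ _
  rw [div_le_iff₀ hcard]
  refine (le_of_eq hsum).trans ((mul_le_mul_of_nonneg_left hle (by positivity)).trans
    (le_of_eq ?_))
  field_simp

end Acceptance

/-! ### The Balog–Szemerédi–Gowers theorem -/

theorem card_filter_prod_eq_sum {α β : Type*} (s : Finset α) (t : Finset β) (p : α → β → Prop)
    [∀ a, DecidablePred (p a)] [DecidablePred fun x : α × β => p x.1 x.2] :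
    #{x ∈ s ×ˢ t | p x.1 x.2} = ∑ a ∈ s, #{b ∈ t | p a b} := by
  simp only [card_filter, sum_product]
  refine sum_congr rfl fun a _ => sum_congr rfl fun b _ => ?_
  split_ifs <;> rfl

section Graph

variable {α : Type*} (A : Finset α) (R : α → α → Prop) [DecidableRel R]

/-- The number of common neighbours. -/
def codegree (a a' : α) : ℕ := #{b ∈ A | R a b ∧ R a' b}

theorem sum_card_bad_le {θ : ℝ} (hθ : 0 ≤ θ) :
    ∑ b ∈ A, (#{p ∈ {a ∈ A | R a b} ×ˢ {a ∈ A | R a b} | (codegree A R p.1 p.2 : ℝ) < θ} : ℝ) ≤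
      #A ^ 2 * θ := by
  have h : ∀ b, #{p ∈ {a ∈ A | R a b} ×ˢ {a ∈ A | R a b} | (codegree A R p.1 p.2 : ℝ) < θ} =
      #{p ∈ {p ∈ A ×ˢ A | (codegree A R p.1 p.2 : ℝ) < θ} | R p.1 b ∧ R p.2 b} := by
    intro b
    congr 1
    ext p
    simp only [mem_filter, mem_product]
    tauto
  simp only [h, natCast_card_filter]
  rw [sum_comm]
  have h2 : ∀ p : α × α, ∑ b ∈ A, (if R p.1 b ∧ R p.2 b then (1 : ℝ) else 0) =
      codegree A R p.1 p.2 := by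
    intro p
    rw [codegree, natCast_card_filter]
  simp only [h2]
  calc ∑ p ∈ A ×ˢ A with (codegree A R p.1 p.2 : ℝ) < θ, (codegree A R p.1 p.2 : ℝ)
      ≤ ∑ p ∈ A ×ˢ A with (codegree A R p.1 p.2 : ℝ) < θ, θ :=
        sum_le_sum fun p hp => (mem_filter.1 hp).2.le
    _ ≤ ∑ p ∈ A ×ˢ A, θ :=
        sum_le_sum_of_subset_of_nonneg (filter_subset _ _) fun _ _ _ => hθ
    _ = #A ^ 2 * θ := by
        rw [sum_const, card_product, nsmul_eq_mul, Nat.cast_mul, sq]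

/-- Dependent random choice. -/
theorem exists_neighbourhood_few_bad {κ : ℝ} (hκ : 0 < κ) (hA : A.Nonempty)
    (h : κ * #A ^ 2 ≤ ∑ b ∈ A, (#{a ∈ A | R a b} : ℝ)) :
    ∃ B ⊆ A, κ / 2 * #A ≤ #B ∧
      8 * (#{p ∈ B ×ˢ B | (codegree A R p.1 p.2 : ℝ) < κ ^ 2 / 16 * #A} : ℝ) ≤ #B ^ 2 := by
  have hm : (0 : ℝ) < #A := by exact_mod_cast hA.card_pos
  have h1 : κ ^ 2 * (#A : ℝ) ^ 3 ≤ ∑ b ∈ A, (#{a ∈ A | R a b} : ℝ) ^ 2 := by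
    have := sq_sum_le_card_mul_sum_sq (s := A) (f := fun b => (#{a ∈ A | R a b} : ℝ))
    have h' : (κ * #A ^ 2) ^ 2 ≤ (∑ b ∈ A, (#{a ∈ A | R a b} : ℝ)) ^ 2 := by gcongr
    refine le_of_mul_le_mul_left ?_ hm
    calc (#A : ℝ) * (κ ^ 2 * #A ^ 3) = (κ * #A ^ 2) ^ 2 := by ring
      _ ≤ _ := h'.trans this
  have h2 := sum_card_bad_le A R (θ := κ ^ 2 / 16 * #A) (by positivity)
  obtain ⟨b, hb, hle⟩ := exists_le_of_sum_le hA (f := fun _ => κ ^ 2 / 2 * (#A : ℝ) ^ 2)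
    (g := fun b => (#{a ∈ A | R a b} : ℝ) ^ 2 - 8 * (#{p ∈ {a ∈ A | R a b} ×ˢ {a ∈ A | R a b} |
      (codegree A R p.1 p.2 : ℝ) < κ ^ 2 / 16 * #A} : ℝ)) (by
      rw [sum_const, nsmul_eq_mul, sum_sub_distrib, ← mul_sum]
      nlinarith)
  refine ⟨{a ∈ A | R a b}, filter_subset _ _, ?_, ?_⟩
  · refine le_of_pow_le_pow_left₀ two_ne_zero (by positivity) ?_
    have : (0 : ℝ) ≤ 8 * (#{p ∈ {a ∈ A | R a b} ×ˢ {a ∈ A | R a b} |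
      (codegree A R p.1 p.2 : ℝ) < κ ^ 2 / 16 * #A} : ℝ) := by positivity
    have h3 : (0 : ℝ) ≤ κ ^ 2 * #A ^ 2 := by positivity
    nlinarith
  · have h3 : (0 : ℝ) ≤ κ ^ 2 / 2 * #A ^ 2 := by positivity
    linarith

/-- A dense graph has a large set of vertices, every two of which are joined by many paths of
length four. -/
theorem exists_subset_many_paths {κ : ℝ} (hκ : 0 < κ) (hA : A.Nonempty)
    (h : κ * #A ^ 2 ≤ ∑ b ∈ A, (#{a ∈ A | R a b} : ℝ)) :
    ∃ B ⊆ A, κ / 4 * #A ≤ #B ∧ ∀ a ∈ B, ∀ a' ∈ B, κ / 4 * (κ ^ 2 / 16) ^ 2 * #A ^ 3 ≤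
      (#{p ∈ A ×ˢ A ×ˢ A | (R a p.2.1 ∧ R p.1 p.2.1) ∧ R a' p.2.2 ∧ R p.1 p.2.2} : ℝ) := by
  obtain ⟨B, hBA, hBcard, hbad⟩ := exists_neighbourhood_few_bad A R hκ hA h
  have hm : (0 : ℝ) < #A := by exact_mod_cast hA.card_pos
  have hB0 : (0 : ℝ) < #B := lt_of_lt_of_le (by positivity) hBcard
  set θ : ℝ := κ ^ 2 / 16 * #A with hθ
  have hθ0 : 0 ≤ θ := by positivity
  set bad : α → ℕ := fun a => #{a' ∈ B | (codegree A R a a' : ℝ) < θ} with hbad_def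
  refine ⟨{a ∈ B | (bad a : ℝ) ≤ #B / 4}, (filter_subset _ _).trans hBA, ?_, ?_⟩
  · rw [card_filter_prod_eq_sum B B fun a a' => (codegree A R a a' : ℝ) < θ] at hbad
    push_cast at hbad
    have h1 : ∑ a ∈ B with ¬ (bad a : ℝ) ≤ #B / 4, (#B : ℝ) / 4 ≤ ∑ a ∈ B, (bad a : ℝ) :=
      (sum_le_sum fun a ha => (not_le.1 (mem_filter.1 ha).2).le).trans
        (sum_le_sum_of_subset_of_nonneg (filter_subset _ _) fun _ _ _ => by positivity)
    have h2 := card_filter_add_card_filter_not (s := B) fun a => (bad a : ℝ) ≤ #B / 4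
    have h2' : (#{a ∈ B | (bad a : ℝ) ≤ #B / 4} : ℝ) + #{a ∈ B | ¬ (bad a : ℝ) ≤ #B / 4} = #B := by
      exact_mod_cast h2
    rw [sum_const, nsmul_eq_mul] at h1
    have h3 : (#{a ∈ B | ¬ (bad a : ℝ) ≤ #B / 4} : ℝ) ≤ #B / 2 := by
      refine le_of_mul_le_mul_right ?_ hB0
      nlinarith
    linarith
  · intro a ha a' ha'
    rw [mem_filter] at ha ha'
    set M : Finset α := {x ∈ B | ¬ ((codegree A R a x : ℝ) < θ ∨ (codegree A R a' x : ℝ) < θ)}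
      with hM
    have hMcard : κ / 4 * #A ≤ #M := by
      have h1 := card_filter_add_card_filter_not (s := B)
        fun x => (codegree A R a x : ℝ) < θ ∨ (codegree A R a' x : ℝ) < θ
      have h2 : #{x ∈ B | (codegree A R a x : ℝ) < θ ∨ (codegree A R a' x : ℝ) < θ} ≤
          bad a + bad a' := by
        classical
        rw [filter_or]
        exact card_union_le _ _
      have h3 : (#B : ℝ) ≤ bad a + bad a' + #M := by
        exact_mod_cast h1.symm.le.trans (Nat.add_le_add_right h2 _)
      linarith [ha.2, ha'.2]
    rw [card_filter_prod_eq_sum A (A ×ˢ A) fun x q =>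
      (R a q.1 ∧ R x q.1) ∧ R a' q.2 ∧ R x q.2]
    have h4 : ∀ x, #{q ∈ A ×ˢ A | (R a q.1 ∧ R x q.1) ∧ R a' q.2 ∧ R x q.2} =
        codegree A R a x * codegree A R a' x := by
      intro x
      rw [codegree, codegree, ← card_product]
      congr 1
      ext q
      simp only [mem_filter, mem_product]
      tauto
    simp only [h4]
    push_cast
    calc κ / 4 * (κ ^ 2 / 16) ^ 2 * (#A : ℝ) ^ 3 = κ / 4 * #A * (θ * θ) := by rw [hθ]; ring
      _ ≤ #M * (θ * θ) := by gcongr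
      _ = ∑ x ∈ M, θ * θ := by rw [sum_const, nsmul_eq_mul]
      _ ≤ ∑ x ∈ M, (codegree A R a x : ℝ) * codegree A R a' x := by
          refine sum_le_sum fun x hx => ?_
          have := (mem_filter.1 hx).2
          push Not at this
          exact mul_le_mul this.1 this.2 hθ0 (by positivity)
      _ ≤ ∑ x ∈ A, (codegree A R a x : ℝ) * codegree A R a' x :=
          sum_le_sum_of_subset_of_nonneg ((filter_subset _ _).trans hBA)
            fun _ _ _ => by positivity

end Graph

section BSG

variable {G : Type*} [AddCommGroup G] [DecidableEq G]

/-- The number of representations as a sum of two elements. -/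
def sumRep (A : Finset G) (s : G) : ℕ := #{q ∈ A ×ˢ A | q.1 + q.2 = s}

theorem addEnergy_eq_sum_sumRep (A : Finset G) :
    A.addEnergy A = ∑ b ∈ A, ∑ a ∈ A, sumRep A (a + b) := by
  rw [addEnergy_eq_card_filter,
    card_filter_prod_eq_sum (A ×ˢ A) (A ×ˢ A) fun p q => p.1 + p.2 = q.1 + q.2, sum_product,
    sum_comm]
  simp only [sumRep, eq_comm]

theorem sumRep_le (A : Finset G) (s : G) : sumRep A s ≤ #A := by
  refine card_le_card_of_injOn Prod.fst (fun q hq => ?_) fun q hq q' hq' h => ?_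
  · simp only [coe_filter, mem_product, Set.mem_ofPred_eq] at hq
    exact hq.1.1
  · simp only [coe_filter, mem_product, Set.mem_ofPred_eq] at hq hq'
    refine Prod.ext h (add_left_cancel (a := q.1) ?_)
    rw [hq.2, h, hq'.2]

theorem addEnergy_le (A : Finset G) : A.addEnergy A ≤ #A ^ 3 := by
  rw [addEnergy_eq_sum_sumRep]
  calc ∑ b ∈ A, ∑ a ∈ A, sumRep A (a + b) ≤ ∑ _b ∈ A, ∑ _a ∈ A, #A :=
        sum_le_sum fun _ _ => sum_le_sum fun _ _ => sumRep_le _ _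
    _ = #A ^ 3 := by
        simp only [sum_const, smul_eq_mul]
        ring

theorem card_popular_mul_le (A : Finset G) (θ : ℝ) :
    (#{s ∈ A + A | θ ≤ sumRep A s} : ℝ) * θ ≤ #A ^ 2 := by
  calc (#{s ∈ A + A | θ ≤ sumRep A s} : ℝ) * θ = ∑ s ∈ A + A with θ ≤ sumRep A s, θ := by
        rw [sum_const, nsmul_eq_mul]
    _ ≤ ∑ s ∈ A + A with θ ≤ sumRep A s, (sumRep A s : ℝ) :=
        sum_le_sum fun s hs => (mem_filter.1 hs).2
    _ ≤ ∑ s ∈ A + A, (sumRep A s : ℝ) :=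
        sum_le_sum_of_subset_of_nonneg (filter_subset _ _) fun _ _ _ => by positivity
    _ = #A ^ 2 := by
        have : #(A ×ˢ A) = ∑ s ∈ A + A, sumRep A s :=
          card_eq_sum_card_fiberwise fun q hq => by
            rw [mem_coe, mem_product] at hq
            exact mem_coe.2 (add_mem_add hq.1 hq.2)
        rw [card_product] at this
        rw [sq]
        exact_mod_cast this.symm

/-- The **Balog–Szemerédi–Gowers theorem**. -/
theorem balog_szemeredi_gowers {A : Finset G} (hA : A.Nonempty) {κ : ℝ} (hκ : 0 < κ)
    (h : 2 * κ * #A ^ 3 ≤ A.addEnergy A) :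
    ∃ B ⊆ A, κ / 4 * #A ≤ #B ∧ (#(B - B) : ℝ) ≤ 4096 / κ ^ 10 * #B := by
  have hm : (0 : ℝ) < #A := by exact_mod_cast hA.card_pos
  classical
  set P : Finset G := {s ∈ A + A | κ * #A ≤ sumRep A s} with hP
  have hPcard : (#P : ℝ) ≤ #A / κ := by
    have := card_popular_mul_le A (κ * #A)
    rw [le_div_iff₀ hκ]
    refine le_of_mul_le_mul_right ?_ hm
    calc (#P : ℝ) * κ * #A = #P * (κ * #A) := by ring
      _ ≤ #A ^ 2 := this
      _ = #A * #A := sq _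
  have hdense : κ * #A ^ 2 ≤ ∑ b ∈ A, (#{a ∈ A | a + b ∈ P} : ℝ) := by
    have h1 : (A.addEnergy A : ℝ) ≤ ∑ b ∈ A, ∑ a ∈ A,
        ((if a + b ∈ P then (#A : ℝ) else 0) + κ * #A) := by
      rw [addEnergy_eq_sum_sumRep]
      push_cast
      refine sum_le_sum fun b hb => sum_le_sum fun a ha => ?_
      have h0 : 0 ≤ κ * #A := by positivity
      split_ifs with hab
      · have : (sumRep A (a + b) : ℝ) ≤ #A := by exact_mod_cast sumRep_le A _
        linarith
      · rw [zero_add]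
        by_contra! hlt
        exact hab (mem_filter.2 ⟨add_mem_add ha hb, hlt.le⟩)
    have h2 : ∑ b ∈ A, ∑ a ∈ A, ((if a + b ∈ P then (#A : ℝ) else 0) + κ * #A) =
        #A * (∑ b ∈ A, (#{a ∈ A | a + b ∈ P} : ℝ)) + κ * #A ^ 3 := by
      simp only [sum_add_distrib, sum_const, nsmul_eq_mul, mul_sum, natCast_card_filter, mul_ite,
        mul_one, mul_zero]
      ring
    rw [h2] at h1
    refine le_of_mul_le_mul_left ?_ hm
    nlinarith
  obtain ⟨B, hBA, hBcard, hpaths⟩ := exists_subset_many_paths A (fun a b => a + b ∈ P) hκ hA hdense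
  refine ⟨B, hBA, hBcard, ?_⟩
  set γ : ℝ := κ / 4 * (κ ^ 2 / 16) ^ 2 with hγ
  have hγ0 : 0 < γ := by positivity
  have hrep : ∀ d ∈ B - B, γ * #A ^ 3 ≤
      (#{t ∈ P ×ˢ P ×ˢ P | t.1 - t.2.1 + t.2.2 - d ∈ P} : ℝ) := by
    intro d hd
    obtain ⟨a, ha, a', ha', rfl⟩ := mem_sub.1 hd
    refine (hpaths a ha a' ha').trans ?_
    norm_cast
    refine card_le_card_of_injOn (fun p => (a + p.2.1, p.1 + p.2.1, p.1 + p.2.2)) ?_ ?_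
    · intro p hp
      simp only [coe_filter, mem_product, Set.mem_ofPred_eq] at hp ⊢
      refine ⟨⟨hp.2.1.1, hp.2.1.2, hp.2.2.2⟩, ?_⟩
      convert hp.2.2.1 using 1
      abel
    · rintro ⟨x, b, b'⟩ - ⟨y, c, c'⟩ - hpq
      simp only [Prod.mk.injEq, add_right_inj] at hpq
      obtain ⟨rfl, h2, h3⟩ := hpq
      obtain rfl := add_right_cancel h2
      obtain rfl := add_left_cancel h3
      rfl
  have hcount : ∑ d ∈ B - B, #{t ∈ P ×ˢ P ×ˢ P | t.1 - t.2.1 + t.2.2 - d ∈ P} ≤ #P ^ 4 := by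
    simp only [card_filter]
    rw [sum_comm]
    simp only [← card_filter]
    calc ∑ t ∈ P ×ˢ P ×ˢ P, #{d ∈ B - B | t.1 - t.2.1 + t.2.2 - d ∈ P} ≤
          ∑ t ∈ P ×ˢ P ×ˢ P, #P := by
          refine sum_le_sum fun t _ => ?_
          refine card_le_card_of_injOn (fun d => t.1 - t.2.1 + t.2.2 - d) ?_ ?_
          · intro d hd
            exact (mem_filter.1 hd).2
          · intro d _ d' _ hdd
            exact sub_right_injective hdd
      _ = #P ^ 4 := by
          rw [sum_const, card_product, card_product, smul_eq_mul]
          ring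
  have hfin : (#(B - B) : ℝ) * (γ * #A ^ 3) ≤ (#A / κ) ^ 4 := by
    calc (#(B - B) : ℝ) * (γ * #A ^ 3) = ∑ d ∈ B - B, γ * (#A : ℝ) ^ 3 := by
          rw [sum_const, nsmul_eq_mul]
      _ ≤ ∑ d ∈ B - B, (#{t ∈ P ×ˢ P ×ˢ P | t.1 - t.2.1 + t.2.2 - d ∈ P} : ℝ) := sum_le_sum hrep
      _ ≤ (#P : ℝ) ^ 4 := by exact_mod_cast hcount
      _ ≤ _ := by gcongr
  calc (#(B - B) : ℝ) ≤ (#A / κ) ^ 4 / (γ * #A ^ 3) := by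
        rwa [le_div_iff₀ (by positivity)]
    _ = 4096 / κ ^ 10 * (κ / 4 * #A) := by
        rw [hγ]
        field_simp
        norm_num
    _ ≤ 4096 / κ ^ 10 * #B := by gcongr

end BSG

/-! ### Sets of small doubling in characteristic two -/

section Freiman

variable {G : Type*} [AddCommGroup G] [Module (ZMod 2) G] [DecidableEq G]

theorem subsetSum_add_mem {F : Finset G} {f x : G} (hf : f ∈ F)
    (hx : x ∈ F.powerset.image fun P => ∑ y ∈ P, y) :
    x + f ∈ F.powerset.image fun P => ∑ y ∈ P, y := by
  obtain ⟨P, hP, rfl⟩ := mem_image.1 hx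
  rw [mem_powerset] at hP
  by_cases hfP : f ∈ P
  · refine mem_image.2 ⟨P.erase f, mem_powerset.2 ((erase_subset _ _).trans hP), ?_⟩
    rw [← sum_erase_add _ _ hfP, add_assoc, ZModModule.add_self, add_zero]
  · refine mem_image.2 ⟨insert f P, mem_powerset.2 (insert_subset hf hP), ?_⟩
    rw [sum_insert hfP, add_comm]

theorem card_closure_le {A F : Finset G} (hA : A.Nonempty) (hF : 3 • A ⊆ F + (A - A)) :
    ∃ T : Finset G, (AddSubgroup.closure (A : Set G) : Set G) ⊆ T ∧ #T ≤ 2 ^ #F * #(A - A) := by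
  refine ⟨(F.powerset.image fun P => ∑ y ∈ P, y) + (A - A), ?_, card_add_le.trans
    (Nat.mul_le_mul_right _ (card_image_le.trans (card_powerset F).le))⟩
  have hstep : ∀ a ∈ A, ∀ y ∈ (F.powerset.image fun P => ∑ y ∈ P, y) + (A - A),
      a + y ∈ (F.powerset.image fun P => ∑ y ∈ P, y) + (A - A) := by
    intro a ha y hy
    obtain ⟨p, hp, d, hd, rfl⟩ := mem_add.1 hy
    obtain ⟨b, hb, c, hc, rfl⟩ := mem_sub.1 hd
    have : a + b + c ∈ 3 • A := by
      rw [succ_nsmul, two_nsmul]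
      exact add_mem_add (add_mem_add ha hb) hc
    obtain ⟨f, hf, d', hd', hfd⟩ := mem_add.1 (hF this)
    refine mem_add.2 ⟨p + f, subsetSum_add_mem hf hp, d', hd', ?_⟩
    rw [add_assoc, hfd, ZModModule.sub_eq_add]
    abel
  intro x hx
  induction hx using AddSubgroup.closure_induction_left with
  | zero =>
    obtain ⟨a, ha⟩ := hA
    refine mem_coe.2 (mem_add.2 ⟨0, mem_image.2 ⟨∅, empty_mem_powerset _, sum_empty⟩, 0,
      mem_sub.2 ⟨a, ha, a, ha, sub_self a⟩, add_zero 0⟩)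
  | add_left a ha y _ ih => exact mem_coe.2 (hstep a ha y ih)
  | neg_add_cancel a ha y _ ih =>
    rw [ZModModule.neg_eq_self]
    exact mem_coe.2 (hstep a ha y ih)

/-- The **Freiman–Ruzsa theorem** in characteristic two. -/
theorem exists_submodule_card_le {A : Finset G} (hA : A.Nonempty) {K : ℝ}
    (hK : (#(A - A) : ℝ) ≤ K * #A) :
    ∃ H : Submodule (ZMod 2) G, (A : Set G) ⊆ H ∧
      ∃ T : Finset G, (H : Set G) ⊆ T ∧ (#T : ℝ) ≤ 2 ^ K ^ 4 * K * #A := by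
  have hm : (0 : ℝ) < #A := by exact_mod_cast hA.card_pos
  have hK0 : 0 ≤ K := by
    by_contra! h
    have : (0 : ℝ) ≤ #(A - A) := by positivity
    nlinarith
  have h4 : (#(3 • A + A) : ℝ) ≤ K ^ 4 * #A := by
    rw [← succ_nsmul]
    have h := pluennecke_ruzsa_inequality_nsmul_sub hA A 4
    have h' : (#(4 • A) : ℝ) ≤ ((#(A - A) : ℝ) / #A) ^ 4 * #A := by
      have := (NNRat.cast_le (K := ℝ)).2 h
      push_cast at this
      exact this
    refine h'.trans ?_
    gcongr
    rwa [div_le_iff₀ hm]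
  obtain ⟨F, -, hFcard, hF⟩ := ruzsa_covering_add hA h4
  obtain ⟨T, hT, hTcard⟩ := card_closure_le hA hF
  refine ⟨AddSubgroup.toZModSubmodule 2 (AddSubgroup.closure (A : Set G)),
    AddSubgroup.subset_closure, T, hT, ?_⟩
  calc (#T : ℝ) ≤ 2 ^ #F * #(A - A) := by exact_mod_cast hTcard
    _ ≤ 2 ^ K ^ 4 * (K * #A) := by
        gcongr
        rw [← Real.rpow_natCast]
        exact Real.rpow_le_rpow_of_exponent_le one_le_two hFcard
    _ = _ := by ring

end Freiman

/-! ### Maps which are additive on many quadruples -/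

/-- A map whose graph over `S` lies in a small subspace is affine on a large part of `S`. -/
theorem exists_affine_of_graph_subset {V W : Type*} [AddCommGroup V] [Module (ZMod 2) V]
    [AddCommGroup W] [Module (ZMod 2) W] [DecidableEq V] [DecidableEq W]
    (H : Submodule (ZMod 2) (V × W)) {T : Finset (V × W)}
    (hT : (H : Set (V × W)) ⊆ T) (S : Finset V) (hS : S.Nonempty) (φ : V → W)
    (hφ : ∀ h ∈ S, (h, φ h) ∈ H) {C : ℝ} (hC : (#T : ℝ) ≤ C * #S) :
    ∃ (L : V →ₗ[ZMod 2] W) (b : W), (#S : ℝ) ≤ C * #{h ∈ S | φ h = L h + b} := by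
  classical
  set p : H →ₗ[ZMod 2] V := (LinearMap.fst (ZMod 2) V W).comp H.subtype with hp
  obtain ⟨g, hg⟩ := p.rangeRestrict.exists_rightInverse_of_surjective p.range_rangeRestrict
  obtain ⟨g', hg'⟩ := LinearMap.exists_extend g
  have hpg : ∀ y : H, p (g' (p y)) = p y := by
    intro y
    have h1 : g' (p y) = g (p.rangeRestrict y) := by
      rw [← hg']
      rfl
    have h2 := congrArg Subtype.val (LinearMap.congr_fun hg (p.rangeRestrict y))
    rw [h1]
    exact h2
  set L : V →ₗ[ZMod 2] W := ((LinearMap.snd (ZMod 2) V W).comp H.subtype).comp g' with hL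
  have hmem : ∀ h ∈ S, ((0 : V), φ h - L h) ∈ H := by
    intro h hh
    have h1 := H.sub_mem (hφ h hh) (g' h).2
    have h2 : ((g' h : H) : V × W).1 = h := hpg ⟨_, hφ h hh⟩
    convert h1 using 1
    exact Prod.ext (by rw [Prod.fst_sub, h2, sub_self]) rfl
  set K : Finset W := S.image fun h => φ h - L h with hK
  have hKS : #K * #S ≤ #T := by
    rw [← card_product]
    refine card_le_card_of_injOn (fun q => (q.2, φ q.2 + q.1)) ?_ ?_
    · rintro ⟨w, h⟩ hwh
      rw [mem_coe, mem_product] at hwh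
      obtain ⟨h', hh', rfl⟩ := mem_image.1 hwh.1
      refine hT ?_
      have := H.add_mem (hφ h hwh.2) (hmem h' hh')
      simpa using this
    · rintro ⟨w, h⟩ - ⟨w', h'⟩ - heq
      simp only [Prod.mk.injEq] at heq
      obtain ⟨rfl, h2⟩ := heq
      rw [add_left_cancel h2]
  have hS0 : (0 : ℝ) < #S := by exact_mod_cast hS.card_pos
  have hKC : (#K : ℝ) ≤ C := by
    refine le_of_mul_le_mul_right ?_ hS0
    refine le_trans ?_ hC
    exact_mod_cast hKS
  have hKne : K.Nonempty := hS.image _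
  have hK0 : (0 : ℝ) < #K := by exact_mod_cast hKne.card_pos
  obtain ⟨b, -, hb⟩ := exists_le_card_fiber_of_nsmul_le_card_of_maps_to (s := S) (t := K)
    (f := fun h => φ h - L h) (b := (#S : ℝ) / #K) (fun h hh => mem_image_of_mem _ hh) hKne (by
      rw [nsmul_eq_mul, mul_div_cancel₀ _ hK0.ne'])
  refine ⟨L, b, ?_⟩
  rw [div_le_iff₀' hK0] at hb
  refine hb.trans ?_
  have : {h ∈ S | φ h - L h = b} = {h ∈ S | φ h = L h + b} :=
    filter_congr fun h _ => sub_eq_iff_eq_add'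
  rw [this]
  gcongr

/-- The number of quadruples `h, h + d, h', h' + d` in `S` on which `φ` is additive. -/
def quadrupleCount (S : Finset (Cube n)) (φ : Cube n → Cube n) : ℕ :=
  #{t : Cube n × Cube n × Cube n | (t.2.1 ∈ S ∧ t.2.1 + t.1 ∈ S) ∧ (t.2.2 ∈ S ∧ t.2.2 + t.1 ∈ S) ∧
    φ t.2.1 + φ (t.2.1 + t.1) + (φ t.2.2 + φ (t.2.2 + t.1)) = 0}

theorem quadrupleCount_le_addEnergy (S : Finset (Cube n)) (φ : Cube n → Cube n) :
    quadrupleCount S φ ≤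
      (S.image fun h => (h, φ h)).addEnergy (S.image fun h => (h, φ h)) := by
  rw [addEnergy_eq_card_filter]
  refine card_le_card_of_injOn (fun t => (((t.2.1, φ t.2.1), (t.2.1 + t.1, φ (t.2.1 + t.1))),
    ((t.2.2, φ t.2.2), (t.2.2 + t.1, φ (t.2.2 + t.1))))) ?_ ?_
  · rintro ⟨d, h, h'⟩ ht
    simp only [coe_filter, mem_univ, true_and, Set.mem_ofPred_eq] at ht
    obtain ⟨⟨h1, h2⟩, ⟨h3, h4⟩, h5⟩ := ht
    simp only [coe_filter, Set.mem_ofPred_eq, mem_product]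
    refine ⟨⟨⟨mem_image_of_mem _ h1, mem_image_of_mem _ h2⟩,
      ⟨mem_image_of_mem _ h3, mem_image_of_mem _ h4⟩⟩, ?_⟩
    refine Prod.ext ?_ (cube_add_eq_zero.1 h5)
    simp only [Prod.fst_add, cube_add_cancel]
  · rintro ⟨d, h, h'⟩ - ⟨d', k, k'⟩ - heq
    simp only [Prod.mk.injEq] at heq
    obtain ⟨⟨⟨rfl, -⟩, h2, -⟩, ⟨rfl, -⟩, -⟩ := heq
    rw [add_left_cancel h2]

/-- A map which is additive on many quadruples agrees with an affine map on a dense set. -/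
theorem exists_affine_agreement {c : ℝ} (hc : 0 < c) : ∃ η : ℝ, 0 < η ∧
    ∀ (n : ℕ) (S : Finset (Cube n)) (φ : Cube n → Cube n),
      c * size n ^ 3 ≤ quadrupleCount S φ →
      ∃ (M : Matrix (Fin n) (Fin n) (ZMod 2)) (b : Cube n),
        η * size n ≤ #{h ∈ S | φ h = M *ᵥ h + b} := by
  set κ : ℝ := c / 2 with hκ
  have hκ0 : 0 < κ := by positivity
  set K : ℝ := 4096 / κ ^ 10 with hK
  have hK0 : 0 < K := by positivity
  have hC0 : (0 : ℝ) < 2 ^ K ^ 4 * K := by positivity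
  refine ⟨κ / 4 * c / (2 ^ K ^ 4 * K), by positivity, fun n S φ hq => ?_⟩
  have hN := size_pos n
  set Γ : Finset (Cube n × Cube n) := S.image fun h => (h, φ h) with hΓ
  have hcard : ∀ S' : Finset (Cube n), #(S'.image fun h => (h, φ h)) = #S' := fun S' =>
    card_image_of_injective _ fun h h' hh => (Prod.mk.inj hh).1
  have hSN : (#S : ℝ) ≤ size n := by
    rw [← card_cube]
    exact_mod_cast card_le_univ S
  have hE : c * size n ^ 3 ≤ Γ.addEnergy Γ := hq.trans (by
    exact_mod_cast quadrupleCount_le_addEnergy S φ)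
  have hES : (Γ.addEnergy Γ : ℝ) ≤ #S ^ 3 := by
    rw [← hcard S]
    exact_mod_cast addEnergy_le Γ
  have hScard : c * size n ≤ #S := by
    refine le_of_mul_le_mul_right ?_ (pow_pos hN 2)
    calc c * size n * size n ^ 2 = c * size n ^ 3 := by ring
      _ ≤ (#S : ℝ) ^ 3 := hE.trans hES
      _ = (#S : ℝ) * (#S : ℝ) ^ 2 := by ring
      _ ≤ (#S : ℝ) * size n ^ 2 := by gcongr
  have hΓne : Γ.Nonempty := by
    rw [← card_pos, hcard]
    have : (0 : ℝ) < #S := lt_of_lt_of_le (by positivity) hScard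
    exact_mod_cast this
  obtain ⟨B, hBΓ, hBcard, hB⟩ := balog_szemeredi_gowers hΓne hκ0 (by
    refine le_trans ?_ hE
    rw [hcard, hκ]
    have : (#S : ℝ) ^ 3 ≤ size n ^ 3 := by gcongr
    nlinarith)
  obtain ⟨S', hS'S, rfl⟩ := subset_image_iff.1 hBΓ
  rw [hcard] at hBcard hB
  rw [hcard] at hBcard
  have hS' : (0 : ℝ) < #S' := lt_of_lt_of_le
    (mul_pos (by positivity) (lt_of_lt_of_le (by positivity) hScard)) hBcard
  have hS'ne : S'.Nonempty := by
    rw [← card_pos]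
    exact_mod_cast hS'
  obtain ⟨H, hAH, T, hHT, hTcard⟩ := exists_submodule_card_le (hS'ne.image fun h => (h, φ h))
    (K := K) (by rwa [hcard])
  rw [hcard] at hTcard
  obtain ⟨L, b, hLb⟩ := exists_affine_of_graph_subset H hHT S' hS'ne φ
    (fun h hh => hAH (mem_coe.2 (mem_image_of_mem _ hh))) hTcard
  refine ⟨LinearMap.toMatrix' L, b, ?_⟩
  simp only [LinearMap.toMatrix'_mulVec]
  rw [div_mul_eq_mul_div, div_le_iff₀' hC0]
  calc κ / 4 * c * size n = κ / 4 * (c * size n) := by ring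
    _ ≤ κ / 4 * #S := by gcongr
    _ ≤ #S' := hBcard
    _ ≤ _ := hLb
    _ ≤ _ := by
      gcongr

/-! ### Large Fourier coefficients of derivatives -/

/-- The multiplicative derivative of `f` in direction `h`. -/
def derivative (f : Cube n → ℝ) (h x : Cube n) : ℝ := f x * f (x + h)

theorem derivative_sq {f : Cube n → ℝ} (hf : ∀ x, f x ^ 2 = 1) (h x : Cube n) :
    derivative f h x ^ 2 = 1 := by
  rw [derivative, mul_pow, hf, hf, one_mul]

theorem sq_sum_le_size_sq {g : Cube n → ℝ} (hg : ∀ x, g x ^ 2 ≤ 1) : (∑ x, g x) ^ 2 ≤ size n ^ 2 := by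
  have := sq_sum_mul_le g (fun _ => 1) hg
  simpa only [mul_one, one_pow, sum_one_cube, card_cube, ← sq] using this

theorem fourier_sq (g : Cube n → ℝ) (a : Cube n) :
    fourier g a ^ 2 = ∑ x, ∑ y, g x * g y * sgn (a ⬝ᵥ (x + y)) := by
  rw [fourier, sum_sq_eq]
  refine sum_congr rfl fun x _ => sum_congr rfl fun y _ => ?_
  rw [dotProduct_add, sgn_add]
  ring

theorem fourier_sq' (g : Cube n → ℝ) (a : Cube n) :
    fourier g a ^ 2 = ∑ x, ∑ k, g x * g (x + k) * sgn (a ⬝ᵥ k) := by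
  rw [fourier_sq]
  refine sum_congr rfl fun x _ => ?_
  rw [← sum_add_left x]
  exact sum_congr rfl fun k _ => by rw [cube_add_cancel]

theorem exists_large_fourier_derivative {f : Cube n → ℝ} (hf : ∀ x, f x ^ 2 = 1) {δ : ℝ}
    (h : δ * size n ^ 4 ≤ cubeSum f) : ∃ (S : Finset (Cube n)) (φ : Cube n → Cube n),
      δ / 2 * size n ≤ #S ∧
      ∀ h ∈ S, δ / 2 * size n ^ 2 ≤ fourier (derivative f h) (φ h) ^ 2 := by
  have hN := size_pos n
  set u : Cube n → ℝ := fun h => ∑ k, (∑ x, derivative f h x * derivative f h (x + k)) ^ 2 with hu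
  have hsum : cubeSum f = ∑ h, u h := by
    refine sum_congr rfl fun h _ => sum_congr rfl fun k _ => ?_
    congr 1
    refine sum_congr rfl fun x _ => ?_
    rw [derivative, derivative, add_right_comm x h k]
    ring
  choose φ hφ using fun h => exists_fourier_sq_ge (derivative f h) (derivative f h)
    fun x => (derivative_sq hf h x).le
  have hule : ∀ h, u h ≤ size n ^ 3 := by
    intro h
    calc u h ≤ ∑ _k : Cube n, size n ^ 2 := sum_le_sum fun k _ => sq_sum_le_size_sq fun x =>
          mul_sq_le_one (derivative_sq hf h x).le (derivative_sq hf h _).le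
      _ = size n ^ 3 := by
          rw [sum_const, card_univ, nsmul_eq_mul, card_cube]
          ring
  refine ⟨univ.filter fun h => δ / 2 * size n ^ 3 ≤ u h, φ, ?_, ?_⟩
  · rw [hsum] at h
    by_cases hδ : 0 ≤ δ
    · have h1 : ∑ h, u h ≤ ∑ h, ((if δ / 2 * size n ^ 3 ≤ u h then size n ^ 3 else 0) +
          δ / 2 * size n ^ 3) := by
        refine sum_le_sum fun h _ => ?_
        have : 0 ≤ δ / 2 * size n ^ 3 := by positivity
        split_ifs with h2
        · linarith [hule h]
        · linarith
      rw [sum_add_distrib, sum_const, card_univ, nsmul_eq_mul, card_cube, ← sum_filter, sum_const,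
        nsmul_eq_mul] at h1
      refine le_of_mul_le_mul_right ?_ (pow_pos hN 3)
      nlinarith
    · refine le_trans ?_ (Nat.cast_nonneg _)
      exact mul_nonpos_of_nonpos_of_nonneg (by linarith) hN.le
  · intro h hh
    refine le_of_mul_le_mul_left ?_ hN
    calc size n * (δ / 2 * size n ^ 2) = δ / 2 * size n ^ 3 := by ring
      _ ≤ u h := (mem_filter.1 hh).2
      _ ≤ _ := hφ h

/-! ### Additive quadruples -/

/-- The character `k ↦ (-1)^(φ(h)·k)`, cut off outside `S`. -/
def cutChar (S : Finset (Cube n)) (φ : Cube n → Cube n) (k h : Cube n) : ℝ :=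
  if h ∈ S then sgn (φ h ⬝ᵥ k) else 0

theorem sum_cutChar_correlation_sq (S : Finset (Cube n)) (φ : Cube n → Cube n) :
    ∑ k, ∑ d, (∑ h, cutChar S φ k h * cutChar S φ k (h + d)) ^ 2 =
      size n * quadrupleCount S φ := by
  have h1 : ∀ d h h' : Cube n, ∑ k, cutChar S φ k h * cutChar S φ k (h + d) *
      (cutChar S φ k h' * cutChar S φ k (h' + d)) =
      size n * if (h ∈ S ∧ h + d ∈ S) ∧ (h' ∈ S ∧ h' + d ∈ S) ∧
        φ h + φ (h + d) + (φ h' + φ (h' + d)) = 0 then 1 else 0 := by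
    intro d h h'
    by_cases hS : (h ∈ S ∧ h + d ∈ S) ∧ (h' ∈ S ∧ h' + d ∈ S)
    · obtain ⟨⟨h1, h2⟩, h3, h4⟩ := hS
      simp only [cutChar, h1, h2, h3, h4, if_true, true_and]
      have : ∀ k, sgn (φ h ⬝ᵥ k) * sgn (φ (h + d) ⬝ᵥ k) *
          (sgn (φ h' ⬝ᵥ k) * sgn (φ (h' + d) ⬝ᵥ k)) =
          sgn (k ⬝ᵥ (φ h + φ (h + d) + (φ h' + φ (h' + d)))) := by
        intro k
        rw [dotProduct_comm k]
        simp only [add_dotProduct, sgn_add]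
      simp only [this, sum_sgn_dotProduct, mul_ite, mul_one, mul_zero]
    · rw [if_neg (by tauto), mul_zero]
      refine sum_eq_zero fun k _ => ?_
      simp only [cutChar]
      split_ifs <;> first | (exfalso; tauto) | simp
  simp only [sum_sq_eq]
  have h2 : ∀ F : Cube n → Cube n → Cube n → Cube n → ℝ,
      ∑ k, ∑ d, ∑ h, ∑ h', F k d h h' = ∑ d, ∑ h, ∑ h', ∑ k, F k d h h' := by
    intro F
    rw [sum_comm]
    refine sum_congr rfl fun d _ => ?_
    rw [sum_comm]
    refine sum_congr rfl fun h _ => ?_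
    rw [sum_comm]
  rw [h2]
  simp only [h1, ← mul_sum]
  rw [quadrupleCount, natCast_card_filter]
  simp only [Fintype.sum_prod_type]

theorem sum_fourier_derivative_pow_le {f : Cube n → ℝ} (hf : ∀ x, f x ^ 2 = 1)
    (S : Finset (Cube n)) (φ : Cube n → Cube n) :
    (∑ h ∈ S, fourier (derivative f h) (φ h) ^ 2) ^ 4 ≤ size n ^ 9 * quadrupleCount S φ := by
  set X := ∑ h ∈ S, fourier (derivative f h) (φ h) ^ 2 with hX
  set Y := ∑ x, ∑ k, (∑ h, derivative f k (x + h) * cutChar S φ k h) ^ 2 with hY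
  have hN := size_pos n
  have h1 : X ^ 2 ≤ size n ^ 2 * Y := by
    refine le_trans (le_of_eq ?_) (sq_sum_sum_mul_le (fun x k => derivative f k x) _
      fun x k => (derivative_sq hf k x).le)
    congr 1
    have hS : X = ∑ h, ∑ x, ∑ k, derivative f h x * derivative f h (x + k) * cutChar S φ k h := by
      calc X = ∑ h, if h ∈ S then fourier (derivative f h) (φ h) ^ 2 else 0 := by
            rw [← sum_filter, filter_mem_eq_inter, univ_inter]
        _ = _ := by
            refine sum_congr rfl fun h _ => ?_
            split_ifs with hS
            · simp only [fourier_sq', cutChar, hS, if_true]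
            · simp only [cutChar, hS, if_false, mul_zero, sum_const_zero]
    rw [hS, sum_comm]
    refine sum_congr rfl fun x _ => ?_
    rw [sum_comm]
    refine sum_congr rfl fun k _ => ?_
    rw [mul_sum]
    refine sum_congr rfl fun h _ => ?_
    simp only [derivative]
    rw [add_right_comm x h k]
    ring
  have h2 : Y ^ 2 ≤ size n ^ 4 * (size n * quadrupleCount S φ) := by
    have hY' : Y = ∑ x, ∑ k, ∑ d, derivative f k x * derivative f k (x + d) *
        ∑ h, cutChar S φ k h * cutChar S φ k (h + d) := by
      calc Y = ∑ k, ∑ h, ∑ x, ∑ h', derivative f k (x + h) * cutChar S φ k h *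
            (derivative f k (x + h') * cutChar S φ k h') := by
            simp only [hY, sum_sq_eq]
            rw [sum_comm]
            refine sum_congr rfl fun k _ => ?_
            rw [sum_comm]
        _ = ∑ k, ∑ h, ∑ x, ∑ d, derivative f k x * derivative f k (x + d) *
            (cutChar S φ k h * cutChar S φ k (h + d)) := by
            refine sum_congr rfl fun k _ => sum_congr rfl fun h _ => ?_
            refine Eq.trans ?_ (sum_add_right h fun x => ∑ d, derivative f k x *
              derivative f k (x + d) * (cutChar S φ k h * cutChar S φ k (h + d)))
            refine sum_congr rfl fun x _ => ?_
            rw [← sum_add_left h]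
            refine sum_congr rfl fun d _ => ?_
            rw [← add_assoc]
            ring
        _ = _ := by
            simp only [mul_sum]
            rw [sum_comm (s := univ) (t := univ) (f := fun x k => ∑ d, ∑ h, derivative f k x *
              derivative f k (x + d) * (cutChar S φ k h * cutChar S φ k (h + d)))]
            refine sum_congr rfl fun k _ => ?_
            rw [sum_comm]
            refine sum_congr rfl fun x _ => ?_
            rw [sum_comm]
    rw [hY', ← sum_cutChar_correlation_sq]
    refine (sq_sum_sum_sum_mul_le (fun x k d => derivative f k x * derivative f k (x + d))
      (fun _ k d => ∑ h, cutChar S φ k h * cutChar S φ k (h + d)) fun x k d =>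
      mul_sq_le_one (derivative_sq hf k x).le (derivative_sq hf k _).le).trans (le_of_eq ?_)
    rw [sum_const, card_univ, nsmul_eq_mul, card_cube]
    ring
  clear_value X Y
  calc X ^ 4 = (X ^ 2) ^ 2 := by ring
    _ ≤ (size n ^ 2 * Y) ^ 2 := by gcongr
    _ = size n ^ 4 * Y ^ 2 := by ring
    _ ≤ size n ^ 4 * (size n ^ 4 * (size n * quadrupleCount S φ)) := by gcongr
    _ = size n ^ 9 * quadrupleCount S φ := by ring

/-- If `f` has large `U³`-norm, then on average over `h` the derivative of `f` in direction `h` has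
a large Fourier coefficient at a point that depends on `h` in an affine way. -/
theorem exists_affine_large_fourier {δ : ℝ} (hδ : 0 < δ) : ∃ η : ℝ, 0 < η ∧
    ∀ (n : ℕ) (f : Cube n → ℝ), (∀ x, f x ^ 2 = 1) → δ * size n ^ 4 ≤ cubeSum f →
      ∃ (M : Matrix (Fin n) (Fin n) (ZMod 2)) (b : Cube n),
        η * size n ^ 3 ≤ ∑ h, fourier (derivative f h) (M *ᵥ h + b) ^ 2 := by
  obtain ⟨η, hη, H⟩ := exists_affine_agreement (c := (δ / 2 * (δ / 2)) ^ 4) (by positivity)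
  refine ⟨η * (δ / 2), by positivity, fun n f hf hU => ?_⟩
  have hN := size_pos n
  obtain ⟨S, φ, hS, hφ⟩ := exists_large_fourier_derivative hf hU
  have hX : δ / 2 * (δ / 2) * size n ^ 3 ≤ ∑ h ∈ S, fourier (derivative f h) (φ h) ^ 2 := by
    calc δ / 2 * (δ / 2) * size n ^ 3 = δ / 2 * size n * (δ / 2 * size n ^ 2) := by ring
      _ ≤ #S * (δ / 2 * size n ^ 2) := by gcongr
      _ = ∑ h ∈ S, δ / 2 * size n ^ 2 := by rw [sum_const, nsmul_eq_mul]
      _ ≤ _ := sum_le_sum hφ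
  obtain ⟨M, b, hMb⟩ := H n S φ (by
    refine le_of_mul_le_mul_left ?_ (pow_pos hN 9)
    refine le_trans ?_ (sum_fourier_derivative_pow_le hf S φ)
    calc size n ^ 9 * ((δ / 2 * (δ / 2)) ^ 4 * size n ^ 3) =
          (δ / 2 * (δ / 2) * size n ^ 3) ^ 4 := by ring
      _ ≤ _ := by gcongr)
  refine ⟨M, b, ?_⟩
  calc η * (δ / 2) * size n ^ 3 = η * size n * (δ / 2 * size n ^ 2) := by ring
    _ ≤ #{h ∈ S | φ h = M *ᵥ h + b} * (δ / 2 * size n ^ 2) := by gcongr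
    _ = ∑ h ∈ S with φ h = M *ᵥ h + b, δ / 2 * size n ^ 2 := by rw [sum_const, nsmul_eq_mul]
    _ ≤ ∑ h ∈ S with φ h = M *ᵥ h + b, fourier (derivative f h) (M *ᵥ h + b) ^ 2 := by
        refine sum_le_sum fun h hh => ?_
        rw [mem_filter] at hh
        rw [← hh.2]
        exact hφ h hh.1
    _ ≤ _ := sum_le_sum_of_subset_of_nonneg (subset_univ _) fun _ _ _ => sq_nonneg _

/-! ### Bilinear forms on the cube -/

/-- The bilinear form of a matrix. -/
def form (M : Matrix (Fin n) (Fin n) (ZMod 2)) (x y : Cube n) : ZMod 2 := (M *ᵥ x) ⬝ᵥ y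

theorem form_add_left (M : Matrix (Fin n) (Fin n) (ZMod 2)) (x x' y : Cube n) :
    form M (x + x') y = form M x y + form M x' y := by
  simp only [form, mulVec_add, add_dotProduct]

theorem form_add_right (M : Matrix (Fin n) (Fin n) (ZMod 2)) (x y y' : Cube n) :
    form M x (y + y') = form M x y + form M x y' := by
  simp only [form, dotProduct_add]

theorem form_add (M M' : Matrix (Fin n) (Fin n) (ZMod 2)) (x y : Cube n) :
    form (M + M') x y = form M x y + form M' x y := by
  simp only [form, add_mulVec, add_dotProduct]

theorem form_transpose (M : Matrix (Fin n) (Fin n) (ZMod 2)) (x y : Cube n) :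
    form Mᵀ x y = form M y x := by
  rw [form, form, mulVec_transpose, ← dotProduct_mulVec, dotProduct_comm]

theorem vecMulVec_mulVec' (a b x : Cube n) : vecMulVec a b *ᵥ x = (b ⬝ᵥ x) • a := by
  ext i
  simp [mulVec, vecMulVec_apply, dotProduct, Finset.mul_sum, mul_comm, mul_left_comm]

theorem form_vecMulVec (a b x y : Cube n) :
    form (vecMulVec a b) x y = (b ⬝ᵥ x) * (a ⬝ᵥ y) := by
  rw [form, vecMulVec_mulVec', smul_dotProduct, smul_eq_mul]

/-- The radical. -/
def radical (M : Matrix (Fin n) (Fin n) (ZMod 2)) : Finset (Cube n) := {y | M *ᵥ y = 0}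

theorem mem_radical {M : Matrix (Fin n) (Fin n) (ZMod 2)} {y : Cube n} :
    y ∈ radical M ↔ M *ᵥ y = 0 := by
  simp [radical]

/-! ### The symmetry argument -/

theorem sum_fourier_affine_eq (f : Cube n → ℝ) (M : Matrix (Fin n) (Fin n) (ZMod 2))
    (b : Cube n) :
    ∑ h, fourier (derivative f h) (M *ᵥ h + b) ^ 2 =
      ∑ z, ∑ x, derivative f z x * sgn (form M x x + form M z x + b ⬝ᵥ x) *
        ∑ y, derivative f z y * sgn (form M y y + form M z y + b ⬝ᵥ y) *
          sgn (form (M + Mᵀ) y x) := by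
  have h1 : ∑ h, fourier (derivative f h) (M *ᵥ h + b) ^ 2 = ∑ x, ∑ y, ∑ h,
      derivative f h x * derivative f h y * sgn ((M *ᵥ h + b) ⬝ᵥ (x + y)) := by
    simp only [fourier_sq]
    rw [sum_comm]
    refine sum_congr rfl fun x _ => ?_
    rw [sum_comm]
  have h2 : ∀ G : Cube n → Cube n → Cube n → ℝ,
      ∑ z, ∑ x, ∑ y, G x y z = ∑ x, ∑ y, ∑ z, G x y z := by
    intro G
    rw [sum_comm]
    refine sum_congr rfl fun x _ => ?_
    rw [sum_comm]
  simp only [h1, mul_sum]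
  rw [h2 fun x y z => derivative f z x * sgn (form M x x + form M z x + b ⬝ᵥ x) *
    (derivative f z y * sgn (form M y y + form M z y + b ⬝ᵥ y) * sgn (form (M + Mᵀ) y x))]
  refine sum_congr rfl fun x _ => sum_congr rfl fun y _ => ?_
  rw [← sum_add_left (x + y)]
  refine sum_congr rfl fun z _ => ?_
  have e1 : x + (x + y + z) = y + z := by rw [add_assoc x y, cube_add_cancel]
  have e2 : y + (x + y + z) = x + z := by rw [add_comm x y, add_assoc y x, cube_add_cancel]
  have e3 : (M *ᵥ (x + y + z) + b) ⬝ᵥ (x + y) = form M x x + form M z x + b ⬝ᵥ x +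
      (form M y y + form M z y + b ⬝ᵥ y) + form (M + Mᵀ) y x := by
    rw [form_add, form_transpose, add_dotProduct, ← form]
    simp only [form_add_left, form_add_right, dotProduct_add]
    ring
  rw [e3, sgn_add, sgn_add]
  simp only [derivative, e1, e2]
  ring

/-- If the derivatives of `f` have large Fourier coefficients along `M`, then the alternating part
of `M` has a large radical. -/
theorem card_radical_ge {f : Cube n → ℝ} (hf : ∀ x, f x ^ 2 = 1)
    (M : Matrix (Fin n) (Fin n) (ZMod 2)) (b : Cube n) :
    (∑ h, fourier (derivative f h) (M *ᵥ h + b) ^ 2) ^ 2 ≤ size n ^ 5 * #(radical (M + Mᵀ)) := by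
  have hN := size_pos n
  have hω : (M + Mᵀ)ᵀ = M + Mᵀ := by rw [transpose_add, transpose_transpose, add_comm]
  rw [sum_fourier_affine_eq]
  set ω := M + Mᵀ
  set F : Cube n → Cube n → ℝ := fun z x =>
    derivative f z x * sgn (form M x x + form M z x + b ⬝ᵥ x) with hF
  have hF1 : ∀ z x, F z x ^ 2 = 1 := by
    intro z x
    rw [hF]
    dsimp only
    rw [mul_pow, derivative_sq hf, sgn_sq, one_mul]
  have hFabs : ∀ z x, |F z x| = 1 := by
    intro z x
    rw [← sq_eq_sq₀ (abs_nonneg _) zero_le_one, sq_abs, hF1, one_pow]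
  refine (sq_sum_sum_mul_le F (fun z x => ∑ y, F z y * sgn (form ω y x))
    fun z x => (hF1 z x).le).trans ?_
  have h1 : ∀ z, ∑ x, (∑ y, F z y * sgn (form ω y x)) ^ 2 ≤ size n ^ 2 * #(radical ω) := by
    intro z
    have h2 : ∀ y y', ∑ x, sgn (form ω y x) * sgn (form ω y' x) =
        size n * if y + y' ∈ radical ω then 1 else 0 := by
      intro y y'
      simp only [← sgn_add, ← form_add_left]
      simp only [form, dotProduct_comm (ω *ᵥ (y + y')), sum_sgn_dotProduct, mem_radical, mul_ite,
        mul_one, mul_zero]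
    have h3 : ∑ x, (∑ y, F z y * sgn (form ω y x)) ^ 2 =
        ∑ y, ∑ y', F z y * F z y' * ∑ x, sgn (form ω y x) * sgn (form ω y' x) := by
      simp only [sum_sq_eq, mul_sum]
      rw [sum_comm]
      refine sum_congr rfl fun y _ => ?_
      rw [sum_comm]
      refine sum_congr rfl fun y' _ => sum_congr rfl fun x _ => ?_
      ring
    rw [h3]
    calc _ ≤ ∑ y, ∑ y', size n * if y + y' ∈ radical ω then (1 : ℝ) else 0 := by
          refine sum_le_sum fun y _ => sum_le_sum fun y' _ => ?_
          rw [h2]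
          refine mul_le_of_le_one_left (mul_nonneg hN.le (by split_ifs <;> norm_num)) ?_
          refine (le_abs_self _).trans ?_
          rw [abs_mul, hFabs, hFabs, one_mul]
      _ = ∑ _y : Cube n, size n * #(radical ω) := by
          refine sum_congr rfl fun y _ => ?_
          rw [sum_add_left y fun d => size n * if d ∈ radical ω then (1 : ℝ) else 0, ← mul_sum]
          simp
      _ = size n ^ 2 * #(radical ω) := by
          rw [sum_const, card_univ, nsmul_eq_mul, card_cube]
          ring
  calc size n ^ 2 * ∑ z, ∑ x, (∑ y, F z y * sgn (form ω y x)) ^ 2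
      ≤ size n ^ 2 * ∑ _z : Cube n, size n ^ 2 * #(radical ω) := by
        gcongr with z
        exact h1 z
    _ = size n ^ 5 * #(radical ω) := by
        rw [sum_const, card_univ, nsmul_eq_mul, card_cube]
        ring

/-! ### From bilinear forms to alternating bilinear forms -/

/-- The weights `F` correlate with the phase of the bilinear form of `M`, up to linear terms. -/
def Correlates (F : Cube n → Cube n → ℝ) (M : Matrix (Fin n) (Fin n) (ZMod 2)) (η : ℝ) : Prop :=
  ∃ l m : Cube n, η ≤ |∑ h, ∑ k, F h k * sgn (form M h k + l ⬝ᵥ h + m ⬝ᵥ k)|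

theorem sgn_eq_rank_one (a b c : ZMod 2) : sgn c =
    (sgn (c + a * b) + sgn (c + a * b + a) + sgn (c + a * b + b) - sgn (c + a * b + a + b)) / 2 := by
  have h2 : (1 : ZMod 2) + 1 = 0 := rfl
  rcases zmod_two_cases a with rfl | rfl <;> rcases zmod_two_cases b with rfl | rfl <;>
    rcases zmod_two_cases c with rfl | rfl <;> simp [h2] <;> norm_num

theorem Correlates.add_rank_one {F : Cube n → Cube n → ℝ} {M : Matrix (Fin n) (Fin n) (ZMod 2)}
    {η : ℝ} (h : Correlates F M η) (a b : Cube n) : Correlates F (M + vecMulVec a b) (η / 2) := by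
  obtain ⟨l, m, h⟩ := h
  set E : Cube n → Cube n → ℝ := fun l m =>
    ∑ h, ∑ k, F h k * sgn (form (M + vecMulVec a b) h k + l ⬝ᵥ h + m ⬝ᵥ k) with hE
  have hsum : ∑ h, ∑ k, F h k * sgn (form M h k + l ⬝ᵥ h + m ⬝ᵥ k) =
      (E l m + E (l + b) m + E l (m + a) - E (l + b) (m + a)) / 2 := by
    simp only [hE, ← sum_add_distrib, ← sum_sub_distrib, sum_div]
    refine sum_congr rfl fun x _ => sum_congr rfl fun y _ => ?_
    rw [sgn_eq_rank_one (b ⬝ᵥ x) (a ⬝ᵥ y), form_add, form_vecMulVec]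
    simp only [add_dotProduct]
    ring_nf
  by_contra hcon
  simp only [Correlates, not_exists, not_le] at hcon
  have h1 := abs_lt.1 (hcon l m)
  have h2 := abs_lt.1 (hcon (l + b) m)
  have h3 := abs_lt.1 (hcon l (m + a))
  have h4 := abs_lt.1 (hcon (l + b) (m + a))
  rw [hsum] at h
  refine absurd h (not_le.2 (abs_lt.2 ?_))
  simp only [hE]
  constructor <;> linarith [h1.1, h1.2, h2.1, h2.2, h3.1, h3.2, h4.1, h4.2]

theorem form_add_transpose_self (M : Matrix (Fin n) (Fin n) (ZMod 2)) (x : Cube n) :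
    form (M + Mᵀ) x x = 0 := by
  rw [form_add, form_transpose, CharTwo.add_self_eq_zero]

theorem form_add_transpose_comm (M : Matrix (Fin n) (Fin n) (ZMod 2)) (x y : Cube n) :
    form (M + Mᵀ) x y = form (M + Mᵀ) y x := by
  rw [form_add, form_add, form_transpose, form_transpose, add_comm]

theorem exists_form_eq_one {M : Matrix (Fin n) (Fin n) (ZMod 2)} (hM : M ≠ 0) :
    ∃ x y, form M x y = 1 := by
  by_contra! h
  refine hM ?_
  ext i j
  have := (zmod_two_cases (form M (Pi.single j 1) (Pi.single i 1))).resolve_right (h _ _)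
  simpa [form] using this

/-- Adding a suitable matrix of rank one to `M` enlarges the radical of the alternating part. -/
theorem exists_rank_one_card_radical {M : Matrix (Fin n) (Fin n) (ZMod 2)} (hM : M + Mᵀ ≠ 0) :
    ∃ a b : Cube n, 2 * #(radical (M + Mᵀ)) ≤
      #(radical (M + vecMulVec a b + (M + vecMulVec a b)ᵀ)) := by
  obtain ⟨u, v, huv⟩ := exists_form_eq_one hM
  have hself := form_add_transpose_self M
  have hcomm := form_add_transpose_comm M
  have hrad : M + vecMulVec ((M + Mᵀ) *ᵥ u) ((M + Mᵀ) *ᵥ v) +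
      (M + vecMulVec ((M + Mᵀ) *ᵥ u) ((M + Mᵀ) *ᵥ v))ᵀ =
      (M + Mᵀ) + vecMulVec ((M + Mᵀ) *ᵥ u) ((M + Mᵀ) *ᵥ v) +
        vecMulVec ((M + Mᵀ) *ᵥ v) ((M + Mᵀ) *ᵥ u) := by
    rw [transpose_add, transpose_vecMulVec]
    abel
  refine ⟨(M + Mᵀ) *ᵥ u, (M + Mᵀ) *ᵥ v, ?_⟩
  rw [hrad]
  set ω := M + Mᵀ
  have hmul : ∀ y, (ω + vecMulVec (ω *ᵥ u) (ω *ᵥ v) + vecMulVec (ω *ᵥ v) (ω *ᵥ u)) *ᵥ y =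
      ω *ᵥ y + form ω v y • (ω *ᵥ u) + form ω u y • (ω *ᵥ v) := by
    intro y
    rw [add_mulVec, add_mulVec, vecMulVec_mulVec', vecMulVec_mulVec', form, form]
  have hzero : ∀ y ∈ radical ω, ∀ x, form ω x y = 0 := by
    intro y hy x
    rw [hcomm, form, mem_radical.1 hy, zero_dotProduct]
  have hu : (ω + vecMulVec (ω *ᵥ u) (ω *ᵥ v) + vecMulVec (ω *ᵥ v) (ω *ᵥ u)) *ᵥ u = 0 := by
    rw [hmul, hcomm v u, huv, hself, one_smul, zero_smul, add_zero, cube_add_self]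
  have hunot : u ∉ radical ω := by
    intro h
    rw [form, mem_radical.1 h, zero_dotProduct] at huv
    exact zero_ne_one huv
  have hsub : ∀ y ∈ radical ω,
      (ω + vecMulVec (ω *ᵥ u) (ω *ᵥ v) + vecMulVec (ω *ᵥ v) (ω *ᵥ u)) *ᵥ y = 0 := by
    intro y hy
    rw [hmul, hzero y hy, hzero y hy, mem_radical.1 hy, zero_smul, zero_smul, add_zero, add_zero]
  have hdisj : Disjoint (radical ω) ((radical ω).image fun y => u + y) := by
    rw [disjoint_left]
    intro y hy hy'
    obtain ⟨z, hz, rfl⟩ := mem_image.1 hy'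
    refine hunot (mem_radical.2 ?_)
    have := mem_radical.1 hy
    rwa [mulVec_add, mem_radical.1 hz, add_zero] at this
  calc 2 * #(radical ω) = #(radical ω ∪ (radical ω).image fun y => u + y) := by
        rw [card_union_of_disjoint hdisj, card_image_of_injective _ (add_right_injective u),
          two_mul]
    _ ≤ _ := by
        refine card_le_card (union_subset (fun y hy => mem_radical.2 (hsub y hy)) ?_)
        intro y hy
        obtain ⟨z, hz, rfl⟩ := mem_image.1 hy
        rw [mem_radical, mulVec_add, hu, hsub z hz, add_zero]

theorem Correlates.exists_symmetric {F : Cube n → Cube n → ℝ} (r : ℕ) :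
    ∀ {M : Matrix (Fin n) (Fin n) (ZMod 2)} {η : ℝ}, 0 ≤ η →
      size n ≤ 2 ^ r * #(radical (M + Mᵀ)) → Correlates F M η →
      ∃ M' : Matrix (Fin n) (Fin n) (ZMod 2), M'ᵀ = M' ∧ Correlates F M' (η / 2 ^ r) := by
  have hsymm : ∀ {M : Matrix (Fin n) (Fin n) (ZMod 2)}, M + Mᵀ = 0 → Mᵀ = M := by
    intro M h
    ext i j
    have := congrFun (congrFun h i) j
    exact (CharTwo.add_eq_zero.1 this).symm
  induction r with
  | zero =>
    intro M η _ hcard hM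
    refine ⟨M, hsymm ?_, by simpa using hM⟩
    by_contra hne
    obtain ⟨u, v, huv⟩ := exists_form_eq_one hne
    have hu : u ∉ radical (M + Mᵀ) := by
      intro h
      rw [form, mem_radical.1 h, zero_dotProduct] at huv
      exact zero_ne_one huv
    have hlt : #(radical (M + Mᵀ)) < Fintype.card (Cube n) := by
      rw [← card_univ]
      exact card_lt_card ((ssubset_iff_of_subset (subset_univ _)).2 ⟨u, mem_univ _, hu⟩)
    rw [pow_zero, one_mul, ← card_cube] at hcard
    exact absurd hcard (not_le.2 (by exact_mod_cast hlt))
  | succ r ih =>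
    intro M η hη hcard hM
    by_cases h0 : M + Mᵀ = 0
    · obtain ⟨l, m, h⟩ := hM
      exact ⟨M, hsymm h0, l, m, (div_le_self hη (one_le_pow₀ one_le_two)).trans h⟩
    · obtain ⟨a, b, hab⟩ := exists_rank_one_card_radical h0
      have hab' : (2 : ℝ) * #(radical (M + Mᵀ)) ≤
        #(radical (M + vecMulVec a b + (M + vecMulVec a b)ᵀ)) := by exact_mod_cast hab
      obtain ⟨M', hM', hc⟩ := ih (div_nonneg hη zero_le_two) (M := M + vecMulVec a b) (by
        calc size n ≤ 2 ^ (r + 1) * #(radical (M + Mᵀ)) := hcard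
          _ = 2 ^ r * (2 * #(radical (M + Mᵀ))) := by ring
          _ ≤ _ := by gcongr) (hM.add_rank_one a b)
      refine ⟨M', hM', ?_⟩
      rwa [div_div, ← pow_succ'] at hc

/-- An alternating form is the polarisation of a quadratic form. -/
theorem exists_eq_add_transpose {M : Matrix (Fin n) (Fin n) (ZMod 2)} (hM : Mᵀ = M)
    (hd : ∀ i, M i i = 0) : ∃ B : Matrix (Fin n) (Fin n) (ZMod 2), M = B + Bᵀ := by
  refine ⟨Matrix.of fun i j => if i < j then M i j else 0, ?_⟩
  ext i j
  simp only [Matrix.add_apply, of_apply, transpose_apply]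
  rcases lt_trichotomy i j with h | rfl | h
  · rw [if_pos h, if_neg h.not_gt, add_zero]
  · rw [if_neg (lt_irrefl i), hd, add_zero]
  · rw [if_neg h.not_gt, if_pos h, zero_add, ← transpose_apply M, hM]

theorem Correlates.exists_polarisation {F : Cube n → Cube n → ℝ} {r : ℕ}
    {M : Matrix (Fin n) (Fin n) (ZMod 2)} {η : ℝ} (hη : 0 ≤ η)
    (hr : size n ≤ 2 ^ r * #(radical (M + Mᵀ))) (hM : Correlates F M η) :
    ∃ B : Matrix (Fin n) (Fin n) (ZMod 2), Correlates F (B + Bᵀ) (η / 2 ^ (r + 1)) := by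
  obtain ⟨M', hM', hc⟩ := Correlates.exists_symmetric r hη hr hM
  obtain ⟨B, hB⟩ := exists_eq_add_transpose
    (M := M' + vecMulVec (fun i => M' i i) fun i => M' i i)
    (by rw [transpose_add, hM', transpose_vecMulVec]) (fun i => by
      rw [Matrix.add_apply, vecMulVec_apply]
      rcases zmod_two_cases (M' i i) with h | h <;> rw [h] <;> rfl)
  refine ⟨B, ?_⟩
  rw [← hB, pow_succ, ← div_div]
  exact hc.add_rank_one _ _

/-! ### The inverse theorem for the Gowers `U³`-norm -/

theorem form_self_add (B : Matrix (Fin n) (Fin n) (ZMod 2)) (x h k : Cube n) :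
    form (B + Bᵀ) h k = form B (x + k) (x + k) + form B (x + k + h) (x + k + h) +
      (form B x x + form B (x + h) (x + h)) := by
  have h2 : (2 : ZMod 2) = 0 := rfl
  rw [form_add, form_transpose]
  simp only [form_add_left, form_add_right]
  linear_combination -(2 * form B x x + form B x h + form B h x + form B h h + form B x k +
    form B k x + form B k k) * h2

/-- If the phase of the polarisation of a quadratic form correlates with the second derivatives of
`f`, then the phase of the quadratic form correlates with `f`, up to a linear term. -/
theorem exists_linear_of_correlates {f : Cube n → ℝ} (hf : ∀ x, f x ^ 2 = 1)
    {B : Matrix (Fin n) (Fin n) (ZMod 2)} {η : ℝ} (hη : 0 ≤ η)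
    (h : Correlates (fun h k => ∑ x, derivative f h x * derivative f h (x + k)) (B + Bᵀ)
      (η * size n ^ 3)) :
    ∃ l : Cube n, η * size n ≤ |∑ x, f x * sgn (form B x x + l ⬝ᵥ x)| := by
  have hN := size_pos n
  obtain ⟨l, m, h⟩ := h
  set G : Cube n → Cube n → ℝ := fun l x => f x * sgn (form B x x + l ⬝ᵥ x) with hG
  have hG1 : ∀ l x, G l x ^ 2 ≤ 1 := by
    intro l x
    rw [hG]
    dsimp only
    rw [mul_pow, hf, sgn_sq, one_mul]
  set W := ∑ h, ∑ k, (∑ x, derivative f h x * derivative f h (x + k)) *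
    sgn (form (B + Bᵀ) h k + l ⬝ᵥ h + m ⬝ᵥ k) with hW
  have hWeq : W = ∑ h, ∑ y, G m y * G 0 (y + h) * ∑ x, G (l + m) x * G l (x + h) := by
    refine sum_congr rfl fun h _ => ?_
    simp only [sum_mul, mul_sum]
    rw [sum_comm]
    conv_rhs => rw [sum_comm]
    refine sum_congr rfl fun x _ => Eq.trans ?_ (sum_add_left x fun y =>
      G m y * G 0 (y + h) * (G (l + m) x * G l (x + h)))
    refine sum_congr rfl fun k _ => ?_
    have h2 : (2 : ZMod 2) = 0 := rfl
    have e : form (B + Bᵀ) h k + l ⬝ᵥ h + m ⬝ᵥ k =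
        (form B (x + k) (x + k) + m ⬝ᵥ (x + k)) +
        (form B (x + k + h) (x + k + h) + 0 ⬝ᵥ (x + k + h)) +
        ((form B x x + (l + m) ⬝ᵥ x) + (form B (x + h) (x + h) + l ⬝ᵥ (x + h))) := by
      rw [form_self_add B x h k]
      simp only [dotProduct_add, add_dotProduct, zero_dotProduct]
      linear_combination -(m ⬝ᵥ x + l ⬝ᵥ x) * h2
    rw [e]
    simp only [hG, derivative]
    rw [sgn_add (_ + _ + (_ + _)), sgn_add (_ + _), sgn_add (_ + _) (_ + _)]
    ring
  obtain ⟨a, ha⟩ := exists_fourier_sq_ge (G (l + m)) (G l) (hG1 l)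
  have hW2 : W ^ 2 ≤ size n ^ 4 * fourier (G (l + m)) a ^ 2 := by
    rw [hWeq]
    refine (sq_sum_sum_mul_le (fun h y => G m y * G 0 (y + h))
      (fun h _ => ∑ x, G (l + m) x * G l (x + h)) fun h y =>
      mul_sq_le_one (hG1 _ _) (hG1 _ _)).trans ?_
    simp only [sum_const, card_univ, nsmul_eq_mul, card_cube]
    rw [← mul_sum]
    calc size n ^ 2 * (size n * ∑ h, (∑ x, G (l + m) x * G l (x + h)) ^ 2)
        ≤ size n ^ 2 * (size n * (size n * fourier (G (l + m)) a ^ 2)) := by gcongr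
      _ = _ := by ring
  have hfour : fourier (G (l + m)) a = ∑ x, f x * sgn (form B x x + (l + m + a) ⬝ᵥ x) := by
    refine sum_congr rfl fun x _ => ?_
    rw [add_dotProduct (l + m) a, ← add_assoc, sgn_add _ (a ⬝ᵥ x), ← mul_assoc]
  refine ⟨l + m + a, ?_⟩
  rw [← hfour]
  refine le_of_mul_le_mul_left (a := size n ^ 2) ?_ (by positivity)
  refine le_of_pow_le_pow_left₀ two_ne_zero (by positivity) ?_
  calc (size n ^ 2 * (η * size n)) ^ 2 = (η * size n ^ 3) ^ 2 := by ring
    _ ≤ |W| ^ 2 := by gcongr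
    _ = W ^ 2 := sq_abs W
    _ ≤ _ := hW2
    _ = (size n ^ 2 * |fourier (G (l + m)) a|) ^ 2 := by
        rw [mul_pow, sq_abs]
        ring

/-- The **inverse theorem for the Gowers `U³`-norm** over the field with two elements. -/
theorem exists_quadratic_correlation {δ : ℝ} (hδ : 0 < δ) : ∃ η : ℝ, 0 < η ∧
    ∀ (n : ℕ) (f : Cube n → ℝ), (∀ x, f x ^ 2 = 1) → δ * size n ^ 4 ≤ cubeSum f →
      ∃ (B : Matrix (Fin n) (Fin n) (ZMod 2)) (l : Cube n),
        η * size n ≤ |∑ x, f x * sgn (form B x x + l ⬝ᵥ x)| := by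
  obtain ⟨η, hη, H⟩ := exists_affine_large_fourier hδ
  obtain ⟨r, hr⟩ := pow_unbounded_of_one_lt (1 / η ^ 2) one_lt_two
  refine ⟨η / 2 ^ (r + 1), by positivity, fun n f hf hU => ?_⟩
  have hN := size_pos n
  obtain ⟨M, b, hMb⟩ := H n f hf hU
  have hrad : size n ≤ 2 ^ r * #(radical (M + Mᵀ)) := by
    have h1 := card_radical_ge hf M b
    have h2 : (η * size n ^ 3) ^ 2 ≤ size n ^ 5 * #(radical (M + Mᵀ)) :=
      le_trans (by gcongr) h1
    have h3 : η ^ 2 * size n ≤ #(radical (M + Mᵀ)) := by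
      refine le_of_mul_le_mul_left ?_ (pow_pos hN 5)
      calc size n ^ 5 * (η ^ 2 * size n) = (η * size n ^ 3) ^ 2 := by ring
        _ ≤ _ := h2
    rw [div_lt_iff₀ (by positivity)] at hr
    calc size n ≤ 2 ^ r * η ^ 2 * size n := le_mul_of_one_le_left hN.le hr.le
      _ = 2 ^ r * (η ^ 2 * size n) := by ring
      _ ≤ _ := by gcongr
  have hcorr : Correlates (fun h k => ∑ x, derivative f h x * derivative f h (x + k)) M
      (η * size n ^ 3) := by
    refine ⟨0, b, hMb.trans (le_trans (le_of_eq ?_) (le_abs_self _))⟩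
    refine sum_congr rfl fun h _ => ?_
    rw [fourier_sq', sum_comm]
    refine sum_congr rfl fun k _ => ?_
    rw [sum_mul, add_dotProduct, zero_dotProduct, add_zero, form]
  obtain ⟨B, hB⟩ := hcorr.exists_polarisation (by positivity) hrad
  obtain ⟨l, hl⟩ := exists_linear_of_correlates hf (B := B) (η := η / 2 ^ (r + 1))
    (by positivity) (by rwa [div_mul_eq_mul_div])
  exact ⟨B, l, hl⟩

/-! ### Completeness -/

/-- The sum of the values of `p` over a three-dimensional cube vanishes. -/
def CubicDerivativeVanishes (p : Cube n → ZMod 2) : Prop :=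
  ∀ a b c, p a + p b + p c + p (a + b) + p (a + c) + p (b + c) + p (a + b + c) + p 0 = 0

theorem cubicDerivativeVanishes_prod {s : Multiset (Fin n)} (hs : s.card ≤ 2) :
    CubicDerivativeVanishes fun x : Cube n => (s.map x).prod := by
  have h2 : (2 : ZMod 2) = 0 := rfl
  intro a b c
  obtain h | h | h : s.card = 0 ∨ s.card = 1 ∨ s.card = 2 := by omega
  · rw [Multiset.card_eq_zero] at h
    subst h
    simp only [Multiset.map_zero, Multiset.prod_zero]
    linear_combination 4 * h2
  · obtain ⟨i, rfl⟩ := Multiset.card_eq_one.1 h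
    simp only [Multiset.map_singleton, Multiset.prod_singleton, Pi.add_apply, Pi.zero_apply]
    linear_combination 2 * (a i + b i + c i) * h2
  · obtain ⟨i, j, rfl⟩ := Multiset.card_eq_two.1 h
    simp only [Multiset.insert_eq_cons, Multiset.map_cons, Multiset.map_singleton,
      Multiset.prod_cons, Multiset.prod_singleton, Pi.add_apply, Pi.zero_apply]
    linear_combination (2 * (a i * a j + b i * b j + c i * c j) + a i * b j + b i * a j +
      a i * c j + c i * a j + b i * c j + c i * b j) * h2

theorem cubicDerivativeVanishes_eval {P : MvPolynomial (Fin n) (ZMod 2)}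
    (hP : P.totalDegree ≤ 2) :
    CubicDerivativeVanishes fun x : Cube n => MvPolynomial.eval x P := by
  intro a b c
  simp only [MvPolynomial.eval_eq, ← sum_add_distrib]
  refine sum_eq_zero fun d hd => ?_
  have hcard : (Finsupp.toMultiset d).card ≤ 2 := by
    rw [Finsupp.card_toMultiset]
    exact (MvPolynomial.le_totalDegree hd).trans hP
  have hprod : ∀ x : Cube n, ∏ i ∈ d.support, x i ^ d i =
      ((Finsupp.toMultiset d).map x).prod := by
    intro x
    rw [Finsupp.toMultiset_map, Finsupp.prod_toMultiset, Finsupp.prod_mapDomain_index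
      (fun _ => pow_zero _) fun _ _ _ => pow_add _ _ _]
    rfl
  have h := cubicDerivativeVanishes_prod hcard a b c
  simp only [hprod]
  simp only [← mul_add]
  rw [h, mul_zero]

theorem neg_one_pow_val_add (a b : ZMod 2) :
    (-1 : ℤˣ) ^ (a + b).val = (-1) ^ a.val * (-1) ^ b.val := by
  revert a b
  decide

theorem quadraticityTest_perfectCompleteness {V : Type*} [Fintype V] [DecidableEq V]
    (H : UniformHypergraph V 3) : (quadraticityTest H).PerfectCompleteness 2 := by
  rintro n f ⟨P, hP, hf⟩ x
  refine (quadraticityTest_accepts_iff' H f x).2 fun i j k _ _ _ _ => ?_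
  have h := cubicDerivativeVanishes_eval hP (x i) (x j) (x k)
  simp only [hf, ← neg_one_pow_val_add]
  rw [CharTwo.add_eq_zero.1 h]

/-! ### Soundness -/

theorem form_self_eq (B : Matrix (Fin n) (Fin n) (ZMod 2)) (x : Cube n) :
    form B x x = ∑ i, ∑ j, B i j * (x j * x i) := by
  simp only [form, mulVec, dotProduct, sum_mul, mul_assoc]

theorem hasDegreeRep_quadratic (B : Matrix (Fin n) (Fin n) (ZMod 2)) (l : Cube n) (c : ZMod 2) :
    HasDegreeRep 2 fun x => (-1 : ℤˣ) ^ (form B x x + l ⬝ᵥ x + c).val := by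
  refine ⟨∑ i, ∑ j, MvPolynomial.C (B i j) * (MvPolynomial.X j * MvPolynomial.X i) +
    ∑ i, MvPolynomial.C (l i) * MvPolynomial.X i + MvPolynomial.C c, ?_, fun x => ?_⟩
  · have hX : ∀ i : Fin n, (MvPolynomial.X i : MvPolynomial (Fin n) (ZMod 2)).totalDegree ≤ 1 :=
      fun i => (MvPolynomial.totalDegree_X i).le
    refine (MvPolynomial.totalDegree_add _ _).trans (max_le
      ((MvPolynomial.totalDegree_add _ _).trans (max_le ?_ ?_)) ?_)
    · refine MvPolynomial.totalDegree_finsetSum_le fun i _ =>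
        MvPolynomial.totalDegree_finsetSum_le fun j _ => ?_
      refine (MvPolynomial.totalDegree_mul _ _).trans ?_
      rw [MvPolynomial.totalDegree_C, zero_add]
      exact (MvPolynomial.totalDegree_mul _ _).trans (add_le_add (hX j) (hX i))
    · refine MvPolynomial.totalDegree_finsetSum_le fun i _ => ?_
      refine (MvPolynomial.totalDegree_mul _ _).trans ?_
      rw [MvPolynomial.totalDegree_C, zero_add]
      exact (hX i).trans one_le_two
    · rw [MvPolynomial.totalDegree_C]
      exact zero_le_two
  · simp only [map_add, map_sum, map_mul, MvPolynomial.eval_C, MvPolynomial.eval_X, form_self_eq,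
      dotProduct]

theorem sum_realFun_mul_eq (f : BoolFun n) (p : Cube n → ZMod 2) :
    ∑ x, realFun f x * sgn (p x) =
      size n * (1 - 2 * dist f fun x => (-1 : ℤˣ) ^ (p x).val) := by
  have h : ∀ x, realFun f x * sgn (p x) =
      1 - 2 * if f x ≠ (-1 : ℤˣ) ^ (p x).val then (1 : ℝ) else 0 := by
    intro x
    rcases Int.units_eq_one_or (f x) with hf | hf <;> rcases zmod_two_cases (p x) with hp | hp <;>
      rw [realFun, hf, hp] <;> norm_num [ZMod.val_one, show (1 : ℤˣ) ≠ -1 by decide,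
        show (-1 : ℤˣ) ≠ 1 by decide]
  simp only [h]
  rw [sum_sub_distrib, sum_one_cube, ← mul_sum, ← natCast_card_filter, dist, hammingDist]
  have hN := (size_pos n).ne'
  rw [size] at *
  field_simp

theorem abs_sum_le_of_isFarFromDegree {f : BoolFun n} {ε : ℝ}
    (hf : IsFarFromDegree 2 (1 / 2 - ε) f) (B : Matrix (Fin n) (Fin n) (ZMod 2)) (l : Cube n) :
    |∑ x, realFun f x * sgn (form B x x + l ⬝ᵥ x)| ≤ 2 * ε * size n := by
  have hN := size_pos n
  have h : ∀ c : ZMod 2, ∑ x, realFun f x * sgn (form B x x + l ⬝ᵥ x + c) ≤ 2 * ε * size n := by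
    intro c
    rw [sum_realFun_mul_eq f fun x => form B x x + l ⬝ᵥ x + c]
    have := hf _ (hasDegreeRep_quadratic B l c)
    nlinarith
  have h0 := h 0
  have h1 := h 1
  simp only [add_zero] at h0
  simp only [sgn_add _ (1 : ZMod 2), sgn_one, mul_neg, mul_one, sum_neg_distrib] at h1
  exact abs_le.2 ⟨by linarith, h0⟩

theorem acceptProb_le_one (T : OracleTest) (f : BoolFun n) : T.acceptProb f ≤ 1 := by
  classical
  refine div_le_one_of_le₀ ?_ (Nat.cast_nonneg _)
  exact_mod_cast card_le_univ _

theorem acceptProb_le_of_isFarFromDegree {V : Type*} [Fintype V] [DecidableEq V]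
    (H : UniformHypergraph V 3) {δ : ℝ} (hδ : 0 < δ) :
    ∃ ε₀ : ℝ, 0 < ε₀ ∧ ∀ (n : ℕ) (f : BoolFun n) (ε : ℝ), ε < ε₀ →
      IsFarFromDegree 2 (1 / 2 - ε) f →
      (quadraticityTest H).acceptProb f ≤ 1 / 2 ^ H.edges.card + δ := by
  obtain ⟨η, hη, h⟩ := exists_quadratic_correlation (δ := δ ^ 8) (by positivity)
  refine ⟨η / 2, by positivity, fun n f ε hε hf => acceptProb_le H f hδ.le ?_⟩
  by_contra! hlt
  obtain ⟨B, l, hBl⟩ := h n (realFun f) (realFun_sq f) hlt.le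
  have h1 := le_of_mul_le_mul_right (hBl.trans (abs_sum_le_of_isFarFromDegree hf B l)) (size_pos n)
  linarith

theorem hasSoundness_of_forall {T : OracleTest} {d : ℕ} {s : ℝ} (hs : 0 ≤ s)
    (h : ∀ δ : ℝ, 0 < δ → ∃ ε₀ : ℝ, 0 < ε₀ ∧ ∀ (n : ℕ) (f : BoolFun n) (ε : ℝ), ε < ε₀ →
      IsFarFromDegree d (1 / 2 - ε) f → T.acceptProb f ≤ s + δ) : T.HasSoundness d s := by
  set D : ℝ → Set ℝ := fun ε => insert 0
    {r | ∃ (n : ℕ) (f : BoolFun n), IsFarFromDegree d (1 / 2 - ε) f ∧ r = T.acceptProb f - s}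
    with hD
  have hbdd : ∀ ε, BddAbove (D ε) := by
    intro ε
    refine ⟨1, ?_⟩
    rintro r (rfl | ⟨n, f, -, rfl⟩)
    · exact zero_le_one
    · linarith [acceptProb_le_one T f]
  refine ⟨fun ε => sSup (D ε), ?_, fun n f ε _ hf => ?_⟩
  · rw [Metric.tendsto_nhdsWithin_nhds]
    intro δ hδ
    obtain ⟨ε₀, hε₀, h⟩ := h (δ / 2) (half_pos hδ)
    refine ⟨ε₀, hε₀, fun ε hε hdist => ?_⟩
    rw [Real.dist_eq, sub_zero, abs_of_pos hε] at hdist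
    rw [Real.dist_eq, sub_zero, abs_of_nonneg (le_csSup (hbdd ε) (Set.mem_insert _ _))]
    refine lt_of_le_of_lt (csSup_le (Set.insert_nonempty _ _) ?_) (half_lt_self hδ)
    rintro r (rfl | ⟨n, f, hf, rfl⟩)
    · positivity
    · linarith [h n f ε hdist hf]
  · have := le_csSup (hbdd ε) (Set.mem_insert_of_mem _ ⟨n, f, hf, rfl⟩)
    linarith

theorem quadraticityTest_solves {V : Type*} [Fintype V] [DecidableEq V]
    (H : UniformHypergraph V 3) :
    (quadraticityTest H).SolvesDegreeTesting 2 (1 / 2 ^ H.edges.card) :=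
  ⟨quadraticityTest_perfectCompleteness H, hasSoundness_of_forall (by positivity) fun _ hδ =>
    acceptProb_le_of_isFarFromDegree H hδ⟩

/-! ### Complete hypergraphs -/

theorem complete_faces {t k : ℕ} (h : k ≤ t) :
    (UniformHypergraph.complete t k).faces = univ.filter fun S => #S ≤ k := by
  ext S
  simp only [UniformHypergraph.faces, UniformHypergraph.complete, mem_biUnion, mem_powersetCard,
    mem_powerset, mem_filter, mem_univ, true_and, subset_univ]
  constructor
  · rintro ⟨e, he, hS⟩
    exact he ▸ card_le_card hS
  · intro hS
    obtain ⟨e, he, hcard⟩ := exists_superset_card_eq hS (by rwa [Fintype.card_fin])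
    exact ⟨e, hcard, he⟩

theorem card_filter_card_le (t k : ℕ) :
    #(univ.filter fun S : Finset (Fin t) => #S ≤ k) = ∑ i ∈ range (k + 1), t.choose i := by
  rw [card_eq_sum_card_fiberwise (f := card) (t := range (k + 1)) fun S hS => by
    simpa [Nat.lt_succ_iff] using hS]
  refine sum_congr rfl fun i hi => ?_
  rw [filter_filter]
  have : (univ.filter fun S : Finset (Fin t) => #S ≤ k ∧ #S = i) = powersetCard i univ := by
    ext S
    simp only [mem_filter, mem_univ, true_and, mem_powersetCard, subset_univ]
    rw [mem_range] at hi
    omega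
  rw [this, card_powersetCard, card_univ, Fintype.card_fin]

theorem two_mul_choose_two (t : ℕ) : 2 * t.choose 2 + t = t ^ 2 := by
  induction t with
  | zero => rfl
  | succ t ih =>
    rw [Nat.choose_succ_succ' t 1, Nat.choose_one_right]
    linarith

theorem six_mul_choose_three (t : ℕ) : 6 * t.choose 3 + 3 * t ^ 2 = t ^ 3 + 2 * t := by
  induction t with
  | zero => rfl
  | succ t ih =>
    rw [Nat.choose_succ_succ' t 2]
    linarith [two_mul_choose_two t]

theorem six_mul_numQueries {t : ℕ} (ht : 3 ≤ t) :
    6 * (quadraticityTest (UniformHypergraph.complete t 3)).numQueries = t ^ 3 + 5 * t + 6 := by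
  rw [quadraticityTest_numQueries, complete_faces ht, card_filter_card_le]
  simp only [sum_range_succ, range_zero, sum_empty, Nat.choose_zero_right, Nat.choose_one_right]
  linarith [two_mul_choose_two t, six_mul_choose_three t]

theorem complete_edges_card (t k : ℕ) :
    #(UniformHypergraph.complete t k).edges = t.choose k := by
  rw [UniformHypergraph.complete, card_powersetCard, card_univ, Fintype.card_fin]

theorem numQueries_complete_eq_zero {t : ℕ} (ht : t < 3) :
    (quadraticityTest (UniformHypergraph.complete t 3)).numQueries = 0 := by
  have : (UniformHypergraph.complete t 3).edges = ∅ := by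
    rw [← card_eq_zero, complete_edges_card, Nat.choose_eq_zero_of_lt ht]
  rw [quadraticityTest_numQueries, UniformHypergraph.faces, this, biUnion_empty, card_empty]

theorem exists_cube_root (q : ℕ) : ∃ y : ℝ, 0 ≤ y ∧ y ^ 3 = q ∧ (q : ℝ) ^ (1 / 3 : ℝ) = y ∧
    (q : ℝ) ^ (2 / 3 : ℝ) = y ^ 2 := by
  have hq : (0 : ℝ) ≤ q := Nat.cast_nonneg q
  refine ⟨(q : ℝ) ^ (1 / 3 : ℝ), by positivity, ?_, rfl, ?_⟩ <;>
    rw [← Real.rpow_natCast, ← Real.rpow_mul hq] <;> norm_num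

theorem inv_two_pow_le {E q : ℕ} {z : ℝ} (h : (q : ℝ) ≤ E + z) :
    (1 : ℝ) / 2 ^ E ≤ 2 ^ z / 2 ^ q := by
  rw [div_le_div_iff₀ (by positivity) (by positivity), one_mul, ← Real.rpow_natCast,
    ← Real.rpow_natCast, ← Real.rpow_add two_pos]
  exact Real.rpow_le_rpow_of_exponent_le one_le_two (by linarith)

/-- The complete hypergraph on `t` vertices has about `q` edges, if `q` is close to the number of
its queries. -/
theorem complete_bounds {t q : ℕ} (ht : 3 ≤ t) (h₁ : t ^ 3 ≤ 6 * q)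
    (h₂ : 6 * q ≤ t ^ 3 + 3 * t ^ 2 + 8 * t + 12) :
    1 / 2 * (q : ℝ) ^ (1 / 3 : ℝ) ≤ t ∧ (t : ℝ) ≤ 8 * (q : ℝ) ^ (1 / 3 : ℝ) ∧
      (1 : ℝ) / 2 ^ #(UniformHypergraph.complete t 3).edges ≤
        2 ^ (8 * (q : ℝ) ^ (2 / 3 : ℝ)) / 2 ^ q := by
  obtain ⟨y, hy, hy3, h3, h4⟩ := exists_cube_root q
  rw [h3, h4, complete_edges_card]
  have ht' : (3 : ℝ) ≤ t := by exact_mod_cast ht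
  have h₁' : (t : ℝ) ^ 3 ≤ 6 * q := by exact_mod_cast h₁
  have h₂' : 6 * (q : ℝ) ≤ t ^ 3 + 3 * t ^ 2 + 8 * t + 12 := by exact_mod_cast h₂
  have hE : 6 * (t.choose 3 : ℝ) + 3 * t ^ 2 = t ^ 3 + 2 * t := by
    exact_mod_cast six_mul_choose_three t
  have ht2 : (3 : ℝ) * t ≤ t ^ 2 := by nlinarith
  have ht3 : (3 : ℝ) * t ^ 2 ≤ t ^ 3 := by nlinarith
  have hyt : y ≤ t := by
    refine le_of_pow_le_pow_left₀ three_ne_zero (by positivity) ?_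
    rw [hy3]
    linarith
  have hty : (t : ℝ) ≤ 2 * y := by
    refine le_of_pow_le_pow_left₀ three_ne_zero (by positivity) ?_
    rw [mul_pow, hy3]
    linarith
  refine ⟨by linarith, by linarith, inv_two_pow_le ?_⟩
  have : (t : ℝ) ^ 2 ≤ (2 * y) ^ 2 := by gcongr
  linarith

theorem exists_complete_bounds {q : ℕ} (hq : 8 ≤ q) :
    ∃ t, 3 ≤ t ∧ t ^ 3 + 5 * t + 6 ≤ 6 * q ∧ 6 * q ≤ t ^ 3 + 3 * t ^ 2 + 8 * t + 12 := by
  have hex : ∃ t, 6 * q < (t + 1) ^ 3 + 5 * (t + 1) + 6 := ⟨6 * q, by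
    linarith [Nat.zero_le ((6 * q + 1) ^ 3)]⟩
  classical
  have hfind := Nat.find_spec hex
  have h3 : 3 ≤ Nat.find hex := by
    rw [Nat.le_find_iff]
    intro m hm
    interval_cases m <;> omega
  refine ⟨Nat.find hex, h3, ?_, ?_⟩
  · have := Nat.find_min hex (m := Nat.find hex - 1) (by omega)
    rwa [Nat.sub_add_cancel (by omega), not_lt] at this
  · linarith

end HypergraphTest

theorem mainTheorem5 :
    -- the hypergraph quadraticity test of any 3-uniform hypergraph
    (∀ (V : Type*) [Fintype V] [DecidableEq V] (H : HypergraphTest.UniformHypergraph V 3),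
      (HypergraphTest.quadraticityTest H).SolvesDegreeTesting 2 (1 / 2 ^ H.edges.card)) ∧
    -- the trade-off between queries and soundness for complete 3-uniform hypergraphs
    ∃ c C : ℝ, 0 < c ∧ 0 < C ∧
      -- with `q` the number of queries of the test on `t` vertices
      (∀ t q : ℕ, 3 ≤ t → q = (HypergraphTest.quadraticityTest
          (HypergraphTest.UniformHypergraph.complete t 3)).numQueries →
        c * (q : ℝ) ^ (1 / 3 : ℝ) ≤ t ∧ (t : ℝ) ≤ C * (q : ℝ) ^ (1 / 3 : ℝ) ∧
        ∃ s : ℝ, (HypergraphTest.quadraticityTest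
            (HypergraphTest.UniformHypergraph.complete t 3)).SolvesDegreeTesting 2 s ∧
          s ≤ (2 : ℝ) ^ (C * (q : ℝ) ^ (2 / 3 : ℝ)) / 2 ^ q) ∧
      -- for every bound `q` on the number of queries
      (∀ q : ℕ, ∃ t : ℕ,
        c * (q : ℝ) ^ (1 / 3 : ℝ) ≤ t ∧ (t : ℝ) ≤ C * (q : ℝ) ^ (1 / 3 : ℝ) ∧
        (HypergraphTest.quadraticityTest
            (HypergraphTest.UniformHypergraph.complete t 3)).numQueries ≤ q ∧
        ∃ s : ℝ, (HypergraphTest.quadraticityTest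
            (HypergraphTest.UniformHypergraph.complete t 3)).SolvesDegreeTesting 2 s ∧
          s ≤ (2 : ℝ) ^ (C * (q : ℝ) ^ (2 / 3 : ℝ)) / 2 ^ q) := by
  refine ⟨fun V _ _ H => HypergraphTest.quadraticityTest_solves H, 1 / 2, 8, by norm_num,
    by norm_num, ?_, ?_⟩
  · rintro t q ht rfl
    have hq := HypergraphTest.six_mul_numQueries ht
    obtain ⟨h1, h2, h3⟩ := HypergraphTest.complete_bounds ht (by rw [hq]; omega)
      (by rw [hq]; nlinarith)
    exact ⟨h1, h2, _, HypergraphTest.quadraticityTest_solves _, h3⟩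
  · intro q
    rcases le_or_gt 8 q with hq | hq
    · obtain ⟨t, ht, h1, h2⟩ := HypergraphTest.exists_complete_bounds hq
      obtain ⟨h3, h4, h5⟩ := HypergraphTest.complete_bounds ht (by omega) h2
      refine ⟨t, h3, h4, ?_, _, HypergraphTest.quadraticityTest_solves _, h5⟩
      have := HypergraphTest.six_mul_numQueries ht
      omega
    · obtain ⟨y, hy, hy3, h3, h4⟩ := HypergraphTest.exists_cube_root q
      rw [h3, h4]
      have hq' : (q : ℝ) < 2 ^ 3 := by
        norm_num
        exact_mod_cast hq
      have hy2 : y < 2 := lt_of_pow_lt_pow_left₀ 3 zero_le_two (hy3 ▸ hq')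
      have hsmall : (q : ℝ) ≤ 0 + 8 * y ^ 2 := by
        rw [← hy3]
        nlinarith [mul_nonneg hy hy]
      rcases Nat.eq_zero_or_pos q with rfl | hpos
      · have hy0 : y = 0 := by
          rw [Nat.cast_zero] at hy3
          exact pow_eq_zero_iff three_ne_zero |>.1 hy3
        refine ⟨0, by simp [hy0], by simp [hy0],
          (HypergraphTest.numQueries_complete_eq_zero (by norm_num)).le, _,
          HypergraphTest.quadraticityTest_solves _, ?_⟩
        exact HypergraphTest.inv_two_pow_le (hsmall.trans (by gcongr; exact Nat.cast_nonneg _))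
      · have hy1 : 1 ≤ y := by
          refine le_of_pow_le_pow_left₀ three_ne_zero hy ?_
          rw [hy3, one_pow]
          exact_mod_cast hpos
        refine ⟨1, ?_, ?_, (HypergraphTest.numQueries_complete_eq_zero (by norm_num)).le.trans
          (Nat.zero_le _), _, HypergraphTest.quadraticityTest_solves _, ?_⟩
        · rw [Nat.cast_one]
          linarith
        · rw [Nat.cast_one]
          linarith
        · exact HypergraphTest.inv_two_pow_le (hsmall.trans (by gcongr; exact Nat.cast_nonneg _))
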